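/- Let $A$ be a unital C$^*$-algebra, let $\mathcal{U}(A)$ be its unitary group with the norm topology, and let $\mathcal{U}_0(A)$ be the connected component of the identity in $\mathcal{U}(A)$. A topological group $G$ is called bounded (in the sense of Hejcman) if for every neighbourhood $V$ of the identity there are $n\in\mathbb{N}$ and a finite set $F\subset G$ with $G=V^nF$; it has property (OB) if, whenever $G$ acts continuously by isometries on a metric space, all orbits are bounded. For $u\in\mathcal{U}_0(A)$ put $$\mathrm{cel}(u)=\inf\Big\{\sum_{k=1}^n\|h_k\| \ :\ u=e^{ih_1}\cdots e^{ih_n},\ h_1,\dots,h_n\in A \text{ self-adjoint}\Big\},$$ and let $\mathrm{cel}(A)=\sup\{\mathrm{cel}(u) : u\in\mathcal{U}_0(A)\}\in[0,\infty]$ be the exponential length of $A$. Then the following conditions are equivalent: (i) $\mathcal{U}_0(A)$ is bounded; (ii) $\mathcal{U}_0(A)$ has property (OB); (iii) $\mathrm{cel}(A)<\infty$. In particular, if $A$ has real rank zero (that is, the invertible self-adjoint elements are norm-dense in the set of self-adjoint elements of $A$), then $\mathcal{U}_0(A)$ is bounded. -/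

import Mathlib

open scoped Pointwise Topology ENNReal

universe u

/-- Boundedness of a topological group in the sense of Hejcman: for every neighbourhood `V` of the
identity there are `n : ℕ` and a finite set `F` such that `G = V ^ n * F`, where
`V ^ n = {v₁ ⋯ vₙ | vᵢ ∈ V}`. -/
def IsHejcmanBounded (G : Type u) [Group G] [TopologicalSpace G] : Prop :=
  ∀ V ∈ 𝓝 (1 : G), ∃ (n : ℕ) (F : Finset G), V ^ n * (F : Set G) = Set.univ

/-- Property (OB): every orbit of every continuous action of `G` by isometries on a metric space
is bounded. Metric spaces in the universe of `G` suffice, because an orbit is an image of `G`. -/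
def HasPropertyOB (G : Type u) [Group G] [TopologicalSpace G] : Prop :=
  ∀ (X : Type u) [MetricSpace X] [MulAction G X] [ContinuousSMul G X] [IsIsometricSMul G X]
    (x : X), Bornology.IsBounded (MulAction.orbit G x)

section CStar

variable (A : Type u) [CStarAlgebra A]

/-- The norm-identity component `U₀(A)` of the unitary group of a unital C⋆-algebra, a topological
group in the norm topology. -/
abbrev identityUnitary : Subgroup (unitary A) :=
  Subgroup.connectedComponentOfOne (unitary A)

variable {A} in
/-- The exponential length of a unitary: the infimum of `‖h₁‖ + ⋯ + ‖hₙ‖` over all ways of writing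
`u = exp (i h₁) ⋯ exp (i hₙ)` with `h₁, …, hₙ` self-adjoint (`selfAdjoint.expUnitary h` is
`exp (i h)`). -/
noncomputable def expLength (u : unitary A) : ℝ≥0∞ :=
  ⨅ (l : List (selfAdjoint A)) (_ : (l.map selfAdjoint.expUnitary).prod = u),
    (l.map fun h => ‖(h : A)‖ₑ).sum

/-- The exponential length `cel(A)`: the supremum of the exponential lengths of the elements of
`U₀(A)`, a value in `[0, ∞]`. -/
noncomputable def cel : ℝ≥0∞ :=
  ⨆ u ∈ identityUnitary A, expLength u

/-- Real rank zero: the invertible self-adjoint elements are norm-dense among the self-adjoint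
elements. -/
def HasRealRankZero : Prop :=
  Dense {a : selfAdjoint A | IsUnit (a : A)}

end CStar

/-! `expLength` is a length function on `U₀(A)`: finite, subadditive, invariant under inversion, at
least `‖u - 1‖`, and tending to `0` at `1` because unitaries near `1` are exponentials of their
arguments. Hence `expLength (x⁻¹ * y)` is a left-invariant metric on which `U₀(A)` acts
continuously, and (OB), applied to the orbit of `1`, bounds `cel A`. Conversely, a product of
exponentials of total length at most `n * r` can be cut into `n` products of length at most `r`
(`exists_list_split`), each within `r` of `1`; so finite `cel A` gives boundedness, which gives (OB)
by the triangle inequality.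

For real rank zero, let `S` be the closure of `{v | ‖v - 1‖ < 2}`. If `S` contains `U₀(A)`, every
`u` is a product of two unitaries at distance less than `2` from `1`, whence `cel A ≤ 2π`. It is
enough that `S` absorbs a thickening of fixed width, since it is then clopen. So let `w = C + ik` be
close to `exp (ia)` with `a` invertible, `‖a‖ < π`, and let `J` be the sign of `a`.

The symmetry `J` almost commutes with `C` and makes `kJ + Jk` almost positive, so `h = glue C k J`
has square bounded below away from the spectral value `-1` of `C`, while `h = k` near it. Thus near
the spectral value `0` of `h` the unitary `w` is `-√(1 - h²) + ih`. Replacing `h` there by a nearby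
invertible element (`patch`) and taking the unitary part (`exists_unitary_near`) gives a unitary
near `w` without `-1` in its spectrum (`exists_unitary_of_patch`). -/

section Group

/-! ### Boundedness implies property (OB) -/

variable {G : Type u} [Group G]

theorem dist_smul_le_of_mem_pow {X : Type*} [MetricSpace X] [MulAction G X] [IsIsometricSMul G X]
    (x : X) {V : Set G} (hV : ∀ g ∈ V, dist (g • x) x ≤ 1) (n : ℕ) :
    ∀ g ∈ V ^ n, dist (g • x) x ≤ n := by
  induction n with
  | zero => intro g hg; rw [pow_zero, Set.mem_one] at hg; simp [hg]
  | succ n ih =>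
    intro g hg
    rw [pow_succ] at hg
    obtain ⟨a, ha, b, hb, rfl⟩ := Set.mem_mul.1 hg
    calc dist ((a * b) • x) x ≤ dist ((a * b) • x) (a • x) + dist (a • x) x := dist_triangle _ _ _
      _ = dist (b • x) x + dist (a • x) x := by rw [mul_smul, dist_smul]
      _ ≤ 1 + n := add_le_add (hV b hb) (ih a ha)
      _ = ((n + 1 : ℕ) : ℝ) := by push_cast; ring

theorem IsHejcmanBounded.hasPropertyOB [TopologicalSpace G] (hG : IsHejcmanBounded G) : HasPropertyOB G := by
  intro X _ _ _ _ x
  have hcont : Continuous fun g : G => dist (g • x) x := by fun_prop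
  have hV : {g : G | dist (g • x) x < 1} ∈ 𝓝 (1 : G) :=
    (isOpen_lt hcont continuous_const).mem_nhds (by simp)
  obtain ⟨n, F, hF⟩ := hG _ hV
  obtain ⟨R, hR⟩ := (F.finite_toSet.image fun g => dist (g • x) x).bddAbove
  refine (Metric.isBounded_closedBall (x := x) (r := R + n)).subset ?_
  rintro _ ⟨g, rfl⟩
  obtain ⟨a, ha, b, hb, rfl⟩ := Set.mem_mul.1 (hF.symm ▸ Set.mem_univ g)
  have hbR : dist (b • x) x ≤ R := hR ⟨b, hb, rfl⟩
  have han := dist_smul_le_of_mem_pow x (V := {g : G | dist (g • x) x < 1}) (fun g hg => hg.le) n a ha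
  rw [Metric.mem_closedBall]
  calc dist ((a * b) • x) x ≤ dist ((a * b) • x) (a • x) + dist (a • x) x := dist_triangle _ _ _
    _ = dist (b • x) x + dist (a • x) x := by rw [mul_smul, dist_smul]
    _ ≤ R + n := add_le_add hbR han

end Group

/-! ### Exponential length as a continuous length function -/

section ExpLength

open selfAdjoint Unitary

variable {A : Type u} [CStarAlgebra A]

theorem mem_identityUnitary_iff {u : unitary A} :
    u ∈ identityUnitary A ↔ ∃ l : List (selfAdjoint A), (l.map expUnitary).prod = u := by
  rw [← mem_pathComponentOne_iff, pathComponent_eq_connectedComponent]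
  rfl

theorem expLength_eq_iInf (u : unitary A) :
    expLength u = ⨅ (l : List (selfAdjoint A)) (_ : (l.map expUnitary).prod = u),
      (l.map fun h : selfAdjoint A => ‖(h : A)‖ₑ).sum := by
  simp [expLength]

theorem expLength_le_of_prod_eq {u : unitary A} {l : List (selfAdjoint A)}
    (h : (l.map expUnitary).prod = u) : expLength u ≤ (l.map fun h : selfAdjoint A => ‖(h : A)‖ₑ).sum :=
  (expLength_eq_iInf u).trans_le (iInf₂_le l h)

theorem expLength_lt_iff {u : unitary A} {r : ℝ≥0∞} :
    expLength u < r ↔ ∃ l : List (selfAdjoint A), (l.map expUnitary).prod = u ∧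
      (l.map fun h : selfAdjoint A => ‖(h : A)‖ₑ).sum < r := by
  simp [expLength_eq_iInf, iInf_lt_iff]

theorem sum_norm_nonneg (l : List (selfAdjoint A)) : 0 ≤ (l.map fun h => ‖h‖).sum :=
  List.sum_nonneg fun x hx => by
    obtain ⟨h, -, rfl⟩ := List.mem_map.1 hx
    exact norm_nonneg h

theorem sum_enorm_eq_ofReal (l : List (selfAdjoint A)) :
    (l.map fun h : selfAdjoint A => ‖(h : A)‖ₑ).sum = ENNReal.ofReal (l.map fun h => ‖h‖).sum := by
  induction l with
  | nil => simp
  | cons a l ih =>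
    have h0 : 0 ≤ (l.map fun h => ‖h‖).sum := sum_norm_nonneg l
    rw [List.map_cons, List.sum_cons, ih, List.map_cons, List.sum_cons,
      ENNReal.ofReal_add (norm_nonneg _) h0, ← ofReal_norm]
    rfl

theorem expLength_lt_top {u : unitary A} (hu : u ∈ identityUnitary A) : expLength u < ⊤ := by
  obtain ⟨l, hl⟩ := mem_identityUnitary_iff.1 hu
  refine expLength_lt_iff.2 ⟨l, hl, ?_⟩
  rw [sum_enorm_eq_ofReal]
  exact ENNReal.ofReal_lt_top

theorem expLength_one : expLength (1 : unitary A) = 0 :=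
  le_antisymm (expLength_le_of_prod_eq (l := ([] : List (selfAdjoint A))) rfl) bot_le

theorem expLength_mul_le (u v : unitary A) : expLength (u * v) ≤ expLength u + expLength v := by
  refine ENNReal.le_of_forall_pos_le_add fun ε hε hfin => ?_
  have hu : expLength u < ⊤ := (le_self_add).trans_lt hfin
  have hv : expLength v < ⊤ := (le_add_self).trans_lt hfin
  have hε2 : (ε / 2 : ℝ≥0∞) ≠ 0 := by simpa using hε.ne'
  obtain ⟨l, hl, hl'⟩ := expLength_lt_iff.1 (ENNReal.lt_add_right hu.ne hε2)
  obtain ⟨m, hm, hm'⟩ := expLength_lt_iff.1 (ENNReal.lt_add_right hv.ne hε2)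
  calc expLength (u * v) ≤ ((l ++ m).map fun h : selfAdjoint A => ‖(h : A)‖ₑ).sum :=
        expLength_le_of_prod_eq (by simp [hl, hm])
    _ ≤ (expLength u + ε / 2) + (expLength v + ε / 2) := by
        rw [List.map_append, List.sum_append]
        exact add_le_add hl'.le hm'.le
    _ = expLength u + expLength v + ε := by
        rw [add_add_add_comm, ENNReal.add_halves]

theorem selfAdjoint.expUnitary_neg (h : selfAdjoint A) : expUnitary (-h) = (expUnitary h)⁻¹ := by
  have : Commute (-h : A) (h : A) := (Commute.refl (h : A)).neg_left
  rw [eq_inv_iff_mul_eq_one, ← Commute.expUnitary_add (a := -h) (b := h) this]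
  simp

theorem expLength_inv_le (u : unitary A) : expLength u⁻¹ ≤ expLength u := by
  rw [expLength_eq_iInf u]
  refine le_iInf₂ fun l hl => ?_
  have key : (((l.map fun h => -h).reverse).map expUnitary).prod = u⁻¹ := by
    rw [← hl, List.prod_inv_reverse, List.map_reverse, List.map_map, List.map_map]
    congr 3
    ext1 h
    exact selfAdjoint.expUnitary_neg h
  refine (expLength_le_of_prod_eq key).trans_eq ?_
  rw [List.map_reverse, List.sum_reverse, List.map_map]
  simp [Function.comp_def]

theorem expLength_inv (u : unitary A) : expLength u⁻¹ = expLength u :=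
  le_antisymm (expLength_inv_le u) (by simpa using expLength_inv_le u⁻¹)

/-- A chord is no longer than its arc as long as `‖h‖ ≤ π`; beyond that the trivial bound `2`
suffices. -/
theorem norm_expUnitary_sub_one_le (h : selfAdjoint A) : ‖(expUnitary h - 1 : A)‖ ≤ ‖h‖ := by
  rcases subsingleton_or_nontrivial A with hA | hA
  · rw [Subsingleton.elim ((expUnitary h : A) - 1) 0, norm_zero]
    exact norm_nonneg _
  rcases le_total ‖h‖ Real.pi with hh | hh
  · refine abs_le_of_sq_le_sq' ?_ (norm_nonneg _) |>.2
    rw [norm_sq_expUnitary_sub_one hh]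
    linarith [Real.one_sub_sq_div_two_le_cos (x := ‖h‖)]
  · calc ‖(expUnitary h - 1 : A)‖ ≤ ‖(expUnitary h : A)‖ + ‖(1 : A)‖ := norm_sub_le _ _
      _ = 2 := by rw [CStarRing.norm_coe_unitary, norm_one]; norm_num
      _ ≤ ‖h‖ := by linarith [Real.pi_gt_three]

theorem norm_prod_expUnitary_sub_one_le (l : List (selfAdjoint A)) :
    ‖((l.map expUnitary).prod - 1 : A)‖ ≤ (l.map fun h => ‖h‖).sum := by
  induction l with
  | nil => simp
  | cons h l ih =>
    rw [List.map_cons, List.prod_cons, List.map_cons, List.sum_cons]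
    set v : unitary A := (l.map expUnitary).prod
    calc ‖((expUnitary h * v : unitary A) - 1 : A)‖
        = ‖(expUnitary h - 1 : A) + (expUnitary h : A) * (v - 1 : A)‖ := by
          congr 1; push_cast; noncomm_ring
      _ ≤ ‖(expUnitary h - 1 : A)‖ + ‖(expUnitary h : A) * (v - 1 : A)‖ := norm_add_le _ _
      _ ≤ ‖h‖ + (l.map fun h => ‖h‖).sum := by
          rw [CStarRing.norm_coe_unitary_mul]
          exact add_le_add (norm_expUnitary_sub_one_le h) ih

theorem enorm_sub_one_le_expLength (u : unitary A) : ‖(u - 1 : A)‖ₑ ≤ expLength u := by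
  rw [expLength_eq_iInf]
  refine le_iInf₂ fun l hl => ?_
  rw [sum_enorm_eq_ofReal, ← hl, ← ofReal_norm]
  exact ENNReal.ofReal_le_ofReal (norm_prod_expUnitary_sub_one_le l)

theorem eq_one_of_expLength_eq_zero {u : unitary A} (hu : expLength u = 0) : u = 1 := by
  have := enorm_sub_one_le_expLength u
  rw [hu, nonpos_iff_eq_zero, enorm_eq_zero, sub_eq_zero] at this
  exact Subtype.ext this

theorem expLength_le_of_norm_sub_one_lt_two {u : unitary A} (hu : ‖(u - 1 : A)‖ < 2) :
    expLength u ≤ ENNReal.ofReal ‖argSelfAdjoint u‖ := by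
  refine (expLength_le_of_prod_eq (l := [argSelfAdjoint u]) ?_).trans_eq ?_
  · simpa using expUnitary_argSelfAdjoint hu
  · simp

theorem tendsto_expLength_nhds_one :
    Filter.Tendsto (fun u : unitary A => (expLength u).toReal) (𝓝 1) (𝓝 0) := by
  have hball : Metric.ball (1 : unitary A) 2 ∈ 𝓝 (1 : unitary A) :=
    Metric.ball_mem_nhds _ two_pos
  have hcont : ContinuousAt (fun u : unitary A => ‖argSelfAdjoint u‖) 1 :=
    (continuousOn_argSelfAdjoint.continuousAt hball).norm
  have h1 : ‖argSelfAdjoint (1 : unitary A)‖ = 0 := by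
    rw [norm_argSelfAdjoint (by simp)]; simp
  rw [ContinuousAt, h1] at hcont
  refine squeeze_zero' (Filter.Eventually.of_forall fun _ => ENNReal.toReal_nonneg) ?_ hcont
  filter_upwards [hball] with u hu
  have hu' : ‖(u - 1 : A)‖ < 2 := by simpa [Subtype.dist_eq, dist_eq_norm] using hu
  exact ENNReal.toReal_le_of_le_ofReal (norm_nonneg _) (expLength_le_of_norm_sub_one_lt_two hu')

/-! ### The exponential-length metric and the action by left translation -/

variable (A) in
/-- The identity component of the unitary group as a set, to carry the metric given by the
exponential length. -/
def ExpLengthSpace : Type u := identityUnitary A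

namespace ExpLengthSpace

instance : MulAction (identityUnitary A) (ExpLengthSpace A) :=
  inferInstanceAs (MulAction (identityUnitary A) (identityUnitary A))

/-- The unitary underlying a point. -/
def toUnitary (x : ExpLengthSpace A) : unitary A := Subtype.val (p := (· ∈ identityUnitary A)) x

theorem toUnitary_mem (x : ExpLengthSpace A) : x.toUnitary ∈ identityUnitary A :=
  Subtype.prop (p := (· ∈ identityUnitary A)) x

theorem toUnitary_smul (g : identityUnitary A) (x : ExpLengthSpace A) :
    (g • x).toUnitary = g * x.toUnitary := rfl

theorem toUnitary_injective : Function.Injective (toUnitary (A := A)) :=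
  Subtype.val_injective (p := (· ∈ identityUnitary A))

theorem expLength_inv_mul_ne_top (x y : ExpLengthSpace A) :
    expLength (x.toUnitary⁻¹ * y.toUnitary) ≠ ⊤ :=
  (expLength_lt_top (mul_mem (inv_mem x.toUnitary_mem) y.toUnitary_mem)).ne

noncomputable instance : MetricSpace (ExpLengthSpace A) where
  dist x y := (expLength (x.toUnitary⁻¹ * y.toUnitary)).toReal
  dist_self x := by simp [expLength_one]
  dist_comm x y := by
    rw [← expLength_inv]
    simp
  dist_triangle x y z := by
    rw [← ENNReal.toReal_add (expLength_inv_mul_ne_top x y) (expLength_inv_mul_ne_top y z)]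
    refine ENNReal.toReal_mono (ENNReal.add_ne_top.2
      ⟨expLength_inv_mul_ne_top x y, expLength_inv_mul_ne_top y z⟩) ?_
    refine le_trans (le_of_eq ?_) (expLength_mul_le _ _)
    congr 1
    group
  eq_of_dist_eq_zero {x y} h := by
    rcases (ENNReal.toReal_eq_zero_iff _).1 h with h | h
    · exact toUnitary_injective (inv_mul_eq_one.1 (eq_one_of_expLength_eq_zero h))
    · exact absurd h (expLength_inv_mul_ne_top x y)

theorem dist_def (x y : ExpLengthSpace A) :
    dist x y = (expLength (x.toUnitary⁻¹ * y.toUnitary)).toReal := rfl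

instance : IsIsometricSMul (identityUnitary A) (ExpLengthSpace A) where
  isometry_smul g := Isometry.of_dist_eq fun x y => by
    simp [dist_def, toUnitary_smul, mul_assoc]

instance : ContinuousSMul (identityUnitary A) (ExpLengthSpace A) where
  continuous_smul := by
    rw [continuous_iff_continuousAt]
    rintro ⟨g₀, x₀⟩
    rw [ContinuousAt, tendsto_iff_dist_tendsto_zero]
    have h1 : Filter.Tendsto (fun p : identityUnitary A × ExpLengthSpace A => dist p.2 x₀)
        (𝓝 (g₀, x₀)) (𝓝 0) := by
      have : Continuous fun p : identityUnitary A × ExpLengthSpace A => dist p.2 x₀ := by fun_prop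
      simpa using this.tendsto (g₀, x₀)
    have h2 : Filter.Tendsto (fun p : identityUnitary A × ExpLengthSpace A =>
        -- Left invariance alone does not give continuity in the group variable: it holds because
        -- `x₀⁻¹ g⁻¹ g₀ x₀` tends to `1` in norm as `g` tends to `g₀`.
        (expLength (((p.1 : unitary A) * x₀.toUnitary)⁻¹ * ((g₀ : unitary A) * x₀.toUnitary))).toReal)
        (𝓝 (g₀, x₀)) (𝓝 0) := by
      refine tendsto_expLength_nhds_one.comp ?_
      have : Continuous fun p : identityUnitary A × ExpLengthSpace A =>
          ((p.1 : unitary A) * x₀.toUnitary)⁻¹ * ((g₀ : unitary A) * x₀.toUnitary) := by fun_prop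
      simpa using this.tendsto (g₀, x₀)
    refine squeeze_zero (fun _ => dist_nonneg) (fun p => ?_) (by simpa only [add_zero] using h1.add h2)
    calc dist (p.1 • p.2) (g₀ • x₀) ≤ dist (p.1 • p.2) (p.1 • x₀) + dist (p.1 • x₀) (g₀ • x₀) :=
          dist_triangle _ _ _
      _ = _ := by rw [dist_smul, dist_def (p.1 • x₀)]; rfl

end ExpLengthSpace

theorem HasPropertyOB.cel_lt_top (h : HasPropertyOB (identityUnitary A)) : cel A < ⊤ := by
  let e : ExpLengthSpace A := (1 : identityUnitary A)
  obtain ⟨R, hR⟩ := (Metric.isBounded_iff_subset_closedBall e).1 (h (ExpLengthSpace A) e)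
  refine lt_of_le_of_lt (iSup₂_le fun u hu => ?_) (ENNReal.ofReal_lt_top (r := R))
  have hmem := hR (MulAction.mem_orbit e (⟨u, hu⟩ : identityUnitary A))
  rw [Metric.mem_closedBall, dist_comm, ExpLengthSpace.dist_def] at hmem
  have heq : e.toUnitary⁻¹ * ((⟨u, hu⟩ : identityUnitary A) • e).toUnitary = u := by
    rw [ExpLengthSpace.toUnitary_smul]
    change (1 : unitary A)⁻¹ * (u * 1) = u
    simp
  rw [heq] at hmem
  exact (ENNReal.le_ofReal_iff_toReal_le (expLength_lt_top hu).ne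
    (ENNReal.toReal_nonneg.trans hmem)).2 hmem

/-! ### Finite exponential length implies boundedness -/

theorem exists_list_split (l : List (selfAdjoint A)) : ∀ {a b : ℝ}, 0 ≤ a → 0 ≤ b →
    (l.map fun h => ‖h‖).sum ≤ a + b → ∃ l₁ l₂ : List (selfAdjoint A),
      (l.map expUnitary).prod = (l₁.map expUnitary).prod * (l₂.map expUnitary).prod ∧
      (l₁.map fun h => ‖h‖).sum ≤ a ∧ (l₂.map fun h => ‖h‖).sum ≤ b := by
  induction l with
  | nil => intro a b ha hb _; exact ⟨[], [], by simp, by simpa, by simpa⟩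
  | cons h l ih =>
    intro a b ha hb hl
    rw [List.map_cons, List.sum_cons] at hl
    rcases le_or_gt ‖h‖ a with hh | hh
    · obtain ⟨l₁, l₂, h1, h2, h3⟩ := ih (a := a - ‖h‖) (b := b) (by linarith) hb (by linarith)
      refine ⟨h :: l₁, l₂, ?_, ?_, h3⟩
      · simp [h1, mul_assoc]
      · rw [List.map_cons, List.sum_cons]; linarith
    · have hpos : 0 < ‖h‖ := ha.trans_lt hh
      -- The factor straddling the cut is divided as `exp (i t h) * exp (i (1 - t) h)`, with `t`
      -- chosen to use up exactly the remaining length `a`.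
      set t : ℝ := a / ‖h‖
      have ht0 : 0 ≤ t := by positivity
      have ht1 : t ≤ 1 := (div_le_one hpos).2 hh.le
      have hta : t * ‖h‖ = a := div_mul_cancel₀ _ hpos.ne'
      refine ⟨[t • h], ((1 - t) • h) :: l, ?_, ?_, ?_⟩
      · have hc : Commute ((t • h : selfAdjoint A) : A) (((1 - t) • h : selfAdjoint A) : A) := by
          rw [selfAdjoint.val_smul, selfAdjoint.val_smul]
          exact ((Commute.refl (h : A)).smul_left _).smul_right _
        rw [List.map_cons, List.map_cons, List.map_cons, List.prod_cons, List.prod_cons,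
          List.prod_cons, List.map_nil, List.prod_nil, mul_one, ← mul_assoc,
          ← hc.expUnitary_add, ← add_smul]
        simp
      · rw [List.map_cons, List.map_nil, List.sum_cons, List.sum_nil, add_zero, norm_smul,
          Real.norm_eq_abs, abs_of_nonneg ht0, hta]
      · rw [List.map_cons, List.sum_cons, norm_smul, Real.norm_eq_abs,
          abs_of_nonneg (by linarith : 0 ≤ 1 - t)]
        linarith

theorem mem_pow_of_sum_le {V : Set (identityUnitary A)} {r : ℝ} (hr : 0 ≤ r)
    (hV : ∀ u : identityUnitary A, ‖((u : unitary A) - 1 : A)‖ ≤ r → u ∈ V) (n : ℕ) :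
    ∀ (u : identityUnitary A) (l : List (selfAdjoint A)), (l.map expUnitary).prod = u →
      (l.map fun h => ‖h‖).sum ≤ n * r → u ∈ V ^ n := by
  induction n with
  | zero =>
    intro u l hl hs
    have := norm_prod_expUnitary_sub_one_le l
    rw [hl] at this
    have h0 : ‖((u : unitary A) - 1 : A)‖ = 0 :=
      le_antisymm (this.trans (by simpa using hs)) (norm_nonneg _)
    rw [norm_eq_zero, sub_eq_zero] at h0
    rw [pow_zero, Set.mem_one]
    exact Subtype.ext (Subtype.ext h0)
  | succ n ih =>
    intro u l hl hs
    obtain ⟨l₁, l₂, h1, h2, h3⟩ := exists_list_split l (a := n * r) (b := r) (by positivity) hr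
      (by push_cast at hs; linarith)
    rw [pow_succ, Set.mem_mul]
    refine ⟨⟨(l₁.map expUnitary).prod, mem_identityUnitary_iff.2 ⟨l₁, rfl⟩⟩, ih _ l₁ rfl h2,
      ⟨(l₂.map expUnitary).prod, mem_identityUnitary_iff.2 ⟨l₂, rfl⟩⟩, hV _ ?_, ?_⟩
    · exact (norm_prod_expUnitary_sub_one_le l₂).trans h3
    · exact Subtype.ext (h1.symm.trans hl)

theorem isHejcmanBounded_of_cel_lt_top (h : cel A < ⊤) :
    IsHejcmanBounded (identityUnitary A) := by
  intro V hV
  obtain ⟨ε, hε, hεV⟩ := Metric.mem_nhds_iff.1 hV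
  obtain ⟨R, hR⟩ := ENNReal.lt_iff_exists_nnreal_btwn.1 h
  obtain ⟨n, hn⟩ := exists_nat_gt ((R : ℝ) / (ε / 2))
  refine ⟨n, {1}, ?_⟩
  rw [Finset.coe_singleton, Set.singleton_one, mul_one, Set.eq_univ_iff_forall]
  intro u
  have hu : expLength (u : unitary A) < R :=
    (le_iSup₂ (f := fun (v : unitary A) (_ : v ∈ identityUnitary A) => expLength v)
      (u : unitary A) u.2).trans_lt hR.1
  obtain ⟨l, hl, hs⟩ := expLength_lt_iff.1 hu
  refine mem_pow_of_sum_le (r := ε / 2) (by positivity) (fun v hv => hεV ?_) n u l hl ?_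
  · rw [Metric.mem_ball, Subtype.dist_eq, Subtype.dist_eq, dist_eq_norm]
    exact hv.trans_lt (by linarith)
  · rw [sum_enorm_eq_ofReal, ENNReal.ofReal_lt_coe_iff (sum_norm_nonneg l)] at hs
    rw [div_lt_iff₀ (by positivity)] at hn
    exact hs.le.trans hn.le

end ExpLength

/-! ### The position element `h = glue C k J` and bounds on its square -/

section Position

/-- The function vanishing on `x ≤ -3/4` and equal to `x + 3/4` beyond. -/
noncomputable def ramp (x : ℝ) : ℝ := max (x + 3 / 4) 0

/-- A continuous function equal to `1` on `x ≤ -7/8` and vanishing on `-3/4 ≤ x`. -/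
noncomputable def plateau (x : ℝ) : ℝ := min 1 (max 0 (8 * (-3 / 4 - x)))

@[fun_prop]
theorem continuous_ramp : Continuous ramp := by unfold ramp; fun_prop

@[fun_prop]
theorem continuous_plateau : Continuous plateau := by unfold plateau; fun_prop

theorem ramp_mul_plateau (x : ℝ) : ramp x * plateau x = 0 := by
  rcases le_total x (-3 / 4) with h | h
  · rw [ramp, max_eq_right (by linarith), zero_mul]
  · rw [plateau, max_eq_left (by linarith), min_eq_right zero_le_one, mul_zero]

theorem plateau_nonneg (x : ℝ) : 0 ≤ plateau x := le_min zero_le_one (le_max_left _ _)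

theorem plateau_mul_nonpos (x : ℝ) : x * plateau x ≤ 0 := by
  rcases le_total x 0 with h | h
  · exact mul_nonpos_of_nonpos_of_nonneg h (plateau_nonneg x)
  · rw [plateau, max_eq_left (by linarith), min_eq_right zero_le_one, mul_zero]

theorem plateau_eq_one {x : ℝ} (h : x ≤ -7 / 8) : plateau x = 1 := by
  rw [plateau, max_eq_right (by linarith), min_eq_left (by linarith)]

theorem le_ramp_mul_ramp (x : ℝ) : x ≤ ramp x * ramp x := by
  rcases le_total x (-3 / 4) with h | h
  · rw [ramp, max_eq_right (by linarith)]; linarith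
  · rw [ramp, max_eq_left (by linarith)]; nlinarith [sq_nonneg (x + 1 / 4)]

theorem ramp_mul_ramp_le_four {x : ℝ} (h1 : x ≤ 1) : ramp x * ramp x ≤ 4 := by
  rcases le_total x (-3 / 4) with h | h
  · rw [ramp, max_eq_right (by linarith)]; linarith
  · rw [ramp, max_eq_left (by linarith)]; nlinarith

theorem ramp_upper {x : ℝ} (h0 : -1 ≤ x) (h1 : x ≤ 1) :
    2 * (1 - x * x) + 8 * (ramp x * ramp x) ≤ 20 * (1 + x) := by
  rcases le_total x (-3 / 4) with h | h
  · rw [ramp, max_eq_right (by linarith)]; nlinarith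
  · rw [ramp, max_eq_left (by linarith)]; nlinarith

/-- The term `1 - x²` carries the bound for negative `x` and the ramp takes over near `1`. The shift
`1/250` collects the two errors `1/500` of `le_glue_mul_self`. -/
theorem ramp_lower {x : ℝ} (h0 : -7 / 8 ≤ x) (h1 : x ≤ 1) :
    1 / 16 ≤ 1 - x * x + ramp x * (x - 1 / 250) * ramp x := by
  rcases le_total x (-3 / 4) with h | h
  · rw [ramp, max_eq_right (by linarith)]; nlinarith
  · rw [ramp, max_eq_left (by linarith)]
    rcases le_total x 0 with h2 | h2
    · nlinarith [mul_nonneg (by linarith : (0 : ℝ) ≤ x + 3 / 4) (by linarith : (0 : ℝ) ≤ -x),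
        mul_nonneg (mul_nonneg (by linarith : (0 : ℝ) ≤ x + 3 / 4) (by linarith : (0 : ℝ) ≤ -x))
          (by linarith : (0 : ℝ) ≤ -x), sq_nonneg x]
    · nlinarith [mul_nonneg h2 h2, mul_nonneg (mul_nonneg h2 h2) h2]

variable {A : Type u} [CStarAlgebra A]

/-- The selfadjoint element which agrees with `k` near the spectral value `-1` of `C` and follows
the symmetry `J` elsewhere. -/
noncomputable def glue (C k J : A) : A := k + cfc ramp C * J * cfc ramp C

theorem isSelfAdjoint_glue {C k J : A} (hk : IsSelfAdjoint k) (hJ : IsSelfAdjoint J) :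
    IsSelfAdjoint (glue C k J) := by
  have h1 : IsSelfAdjoint (cfc ramp C) := cfc_predicate ramp C
  refine hk.add ?_
  rw [IsSelfAdjoint, star_mul, star_mul, hJ.star_eq, h1.star_eq, mul_assoc]

variable [PartialOrder A] [StarOrderedRing A]

theorem abs_le_one_of_mem_spectrum {C k : A} (hC : IsSelfAdjoint C) (hk : IsSelfAdjoint k)
    (h : C * C + k * k = 1) {x : ℝ} (hx : x ∈ spectrum ℝ C) : -1 ≤ x ∧ x ≤ 1 := by
  have h1 : C * C ≤ 1 := by
    rw [← h]
    exact le_add_of_nonneg_right (by simpa [hk.star_eq] using star_mul_self_nonneg k)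
  have h2 : cfc (fun x : ℝ => x * x) C ≤ cfc (fun _ : ℝ => (1 : ℝ)) C := by
    rw [cfc_mul (fun x : ℝ => x) (fun x : ℝ => x) C, cfc_id' ℝ C, cfc_const_one ℝ C]
    exact h1
  have h3 := (cfc_le_iff _ _ C).1 h2 x hx
  exact abs_le.1 (abs_le_one_iff_mul_self_le_one.2 h3)

/-- With `w = pJp`, the square of `k + w` is at most `2k² + 2w²`; here `k² = 1 - C²` and `w² ≤ 4p²`,
so a scalar inequality in `C` remains. The outcome makes `2(1 + C)`, the sum `2 + w + w*` for the
unitary `w`, dominate `h² / 10`. -/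
theorem glue_mul_self_le {C k J : A} (hC : IsSelfAdjoint C) (hk : IsSelfAdjoint k)
    (hJ : IsSelfAdjoint J) (hsum : C * C + k * k = 1) (hJJ : J * J = 1) :
    glue C k J * glue C k J ≤ (20 : ℝ) • (1 + C) := by
  set p := cfc ramp C with hp
  have hps : IsSelfAdjoint p := cfc_predicate ramp C
  set w := p * J * p with hw
  have hws : IsSelfAdjoint w := by
    rw [IsSelfAdjoint, hw, star_mul, star_mul, hJ.star_eq, hps.star_eq, mul_assoc]
  have hpp : p * p ≤ algebraMap ℝ A 4 := by
    rw [hp, ← cfc_mul ramp ramp C, ← cfc_const (4 : ℝ) C]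
    exact cfc_mono fun x hx => ramp_mul_ramp_le_four (abs_le_one_of_mem_spectrum hC hk hsum hx).2
  have hww : w * w ≤ (4 : ℝ) • (p * p) := by
    have := star_left_conjugate_le_conjugate hpp (J * p)
    rw [star_mul, hJ.star_eq, hps.star_eq] at this
    calc w * w = p * J * (p * p) * (J * p) := by rw [hw]; noncomm_ring
      _ ≤ p * J * algebraMap ℝ A 4 * (J * p) := this
      _ = (4 : ℝ) • (p * (J * J) * p) := by
          rw [Algebra.algebraMap_eq_smul_one]; simp only [mul_smul_comm, smul_mul_assoc, mul_one,
            mul_assoc]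
      _ = (4 : ℝ) • (p * p) := by rw [hJJ, mul_one]
  have hkw : 0 ≤ (k - w) * (k - w) := by
    simpa [(hk.sub hws).star_eq] using star_mul_self_nonneg (k - w)
  have hkk : k * k = 1 - C * C := by rw [← hsum]; abel
  have hfin : (2 : ℝ) • (1 - C * C) + (8 : ℝ) • (p * p) ≤ (20 : ℝ) • (1 + C) := by
    have e1 : (2 : ℝ) • (1 - C * C) + (8 : ℝ) • (p * p)
        = cfc (fun x => 2 * (1 - x * x) + 8 * (ramp x * ramp x)) C := by
      rw [cfc_add C (fun x => 2 * (1 - x * x)) (fun x => 8 * (ramp x * ramp x)),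
        cfc_const_mul 2 (fun x => 1 - x * x) C, cfc_const_mul 8 (fun x => ramp x * ramp x) C,
        cfc_mul ramp ramp C, cfc_sub (fun _ => 1) (fun x => x * x) C, cfc_const_one ℝ C,
        cfc_mul (fun x => x) (fun x => x) C, cfc_id' ℝ C]
    have e2 : (20 : ℝ) • (1 + C) = cfc (fun x : ℝ => 20 * (1 + x)) C := by
      rw [cfc_const_mul 20 (fun x => 1 + x) C, cfc_add C (fun _ => 1) (fun x => x),
        cfc_const_one ℝ C, cfc_id' ℝ C]
    rw [e1, e2]
    exact cfc_mono fun x hx => ramp_upper (abs_le_one_of_mem_spectrum hC hk hsum hx).1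
      (abs_le_one_of_mem_spectrum hC hk hsum hx).2
  calc glue C k J * glue C k J ≤ (k + w) * (k + w) + (k - w) * (k - w) :=
        le_add_of_nonneg_right hkw
    _ = (2 : ℝ) • (k * k) + (2 : ℝ) • (w * w) := by
        simp only [two_smul]; noncomm_ring
    _ ≤ (2 : ℝ) • (1 - C * C) + (2 : ℝ) • ((4 : ℝ) • (p * p)) := by
        rw [hkk]; gcongr
    _ = (2 : ℝ) • (1 - C * C) + (8 : ℝ) • (p * p) := by rw [smul_smul]; norm_num
    _ ≤ _ := hfin

/-- As `p` commutes with `k`, `h² = k² + p(Jp²J)p + p(kJ + Jk)p`. Since `C ≤ p²`, the middle factor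
is at least `JCJ`, and both hypotheses on `J` apply. -/
theorem le_glue_mul_self {C k J : A} (hC : IsSelfAdjoint C)
    (hCk : Commute C k) (hsum : C * C + k * k = 1)
    (hJ : IsSelfAdjoint J)
    (hJC : C - algebraMap ℝ A (1 / 500) ≤ J * C * J)
    (hkJ : -algebraMap ℝ A (1 / 500) ≤ k * J + J * k) :
    cfc (fun x => 1 - x * x + ramp x * (x - 1 / 250) * ramp x) C ≤ glue C k J * glue C k J := by
  set p := cfc ramp C with hp
  have hps : IsSelfAdjoint p := cfc_predicate ramp C
  have hpk : p * k = k * p := (hCk.cfc_real ramp).eq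
  have hpp : C ≤ p * p := by
    rw [hp, ← cfc_mul ramp ramp C]
    nth_rewrite 1 [← cfc_id' ℝ C]
    exact cfc_mono fun x _ => le_ramp_mul_ramp x
  have h1 : p * (C - algebraMap ℝ A (1 / 500)) * p ≤ p * J * (p * p) * J * p := by
    have e : J * C * J ≤ J * (p * p) * J := hJ.conjugate_le_conjugate hpp
    have := hps.conjugate_le_conjugate (hJC.trans e)
    refine this.trans_eq ?_
    noncomm_ring
  have h2 : p * (-algebraMap ℝ A (1 / 500)) * p ≤ p * (k * J + J * k) * p :=
    hps.conjugate_le_conjugate hkJ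
  have e1 : cfc (fun x => 1 - x * x + ramp x * (x - 1 / 250) * ramp x) C
      = k * k + (p * (C - algebraMap ℝ A (1 / 500)) * p
        + p * (-algebraMap ℝ A (1 / 500)) * p) := by
    rw [cfc_add C (fun x => 1 - x * x) (fun x => ramp x * (x - 1 / 250) * ramp x),
      cfc_sub (fun _ => 1) (fun x => x * x) C, cfc_const_one ℝ C,
      cfc_mul (fun x => x) (fun x => x) C, cfc_id' ℝ C,
      cfc_mul (fun x => ramp x * (x - 1 / 250)) ramp C,
      cfc_mul ramp (fun x => x - 1 / 250) C, cfc_sub (fun x => x) (fun _ => 1 / 250) C,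
      cfc_id' ℝ C, cfc_const (1 / 250 : ℝ) C, ← add_mul, ← mul_add, ← hsum]
    congr 1
    · abel
    · congr 2
      rw [← sub_eq_add_neg, sub_sub, ← map_add]
      norm_num
  have e2 : glue C k J * glue C k J
      = k * k + (p * J * (p * p) * J * p + p * (k * J + J * k) * p) := by
    rw [glue, ← hp]
    have : k * (p * J * p) + (p * J * p) * k = p * (k * J + J * k) * p := by
      have a : k * (p * J * p) = p * (k * J) * p := by
        rw [← mul_assoc, ← mul_assoc, ← hpk]; noncomm_ring
      have b : (p * J * p) * k = p * (J * k) * p := by rw [mul_assoc, hpk]; noncomm_ring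
      rw [a, b]; noncomm_ring
    rw [← this]; noncomm_ring
  rw [e1, e2]
  gcongr

end Position

/-! ### Near the spectral value `0` of `h`, the unitary is a function of `h` -/

section Localization

variable {A : Type u} [CStarAlgebra A]

theorem glue_mul_plateau (C k J : A) :
    glue C k J * cfc plateau C = k * cfc plateau C := by
  have h : cfc ramp C * cfc plateau C = 0 := by
    rw [← cfc_mul ramp plateau C]
    simp only [ramp_mul_plateau]
    exact cfc_const_zero ℝ C
  rw [glue, add_mul, mul_assoc, h, mul_zero, add_zero]

theorem plateau_mul_glue {C k : A} (J : A) (hCk : Commute C k) :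
    cfc plateau C * glue C k J = k * cfc plateau C := by
  have h : cfc plateau C * cfc ramp C = 0 := by
    rw [← cfc_mul plateau ramp C]
    simp only [fun x => (mul_comm (plateau x) (ramp x)).trans (ramp_mul_plateau x)]
    exact cfc_const_zero ℝ C
  rw [glue, mul_add, ← mul_assoc, ← mul_assoc, h, zero_mul, zero_mul, add_zero,
    (hCk.cfc_real plateau).eq]

theorem commute_plateau_glue {C k : A} (J : A) (hCk : Commute C k) :
    Commute (glue C k J) (cfc plateau C) :=
  (glue_mul_plateau C k J).trans (plateau_mul_glue J hCk).symm

variable [PartialOrder A] [StarOrderedRing A]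

/-- Functions of `glue C k J` supported near `0` live in the spectral region of `C` near `-1`. -/
theorem plateau_mul_cfc_glue {C k J : A} (hC : IsSelfAdjoint C) (hk : IsSelfAdjoint k)
    (hCk : Commute C k) (hsum : C * C + k * k = 1) (hJ : IsSelfAdjoint J)
    (hle : cfc (fun x => 1 - x * x + ramp x * (x - 1 / 250) * ramp x) C
      ≤ glue C k J * glue C k J)
    {b : ℝ → ℝ} (hb : Continuous b) (hb0 : ∀ x, 1 / 6 ≤ |x| → b x = 0) :
    cfc plateau C * cfc b (glue C k J) = cfc b (glue C k J) := by
  set h := glue C k J with hh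
  have hs : IsSelfAdjoint h := isSelfAdjoint_glue hk hJ
  set f := cfc plateau C with hf
  set B := cfc b h with hB
  set D := 1 - f with hD
  have hDs : IsSelfAdjoint D := (IsSelfAdjoint.one A).sub (cfc_predicate plateau C)
  have hBs : IsSelfAdjoint B := cfc_predicate b h
  have hfB : Commute B f := (commute_plateau_glue J hCk).cfc_real b
  have hDB : Commute B D := (Commute.one_right B).sub_right hfB
  -- On `D` the square of `h` is at least `1/16`, on `B` at most `1/36`. As `D` and `B` commute,
  -- compressing by both forces `D * B = 0`.
  have h1 : (1 / 16 : ℝ) • (D * D) ≤ D * (h * h) * D := by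
    refine le_trans ?_ (hDs.conjugate_le_conjugate hle)
    have eD : D = cfc (fun x => 1 - plateau x) C := by
      rw [cfc_sub (fun _ => 1) plateau C, cfc_const_one ℝ C]
    rw [eD, ← cfc_mul (fun x => 1 - plateau x) (fun x => 1 - plateau x) C,
      ← cfc_const_mul (1 / 16) _ C, ← cfc_mul _ _ C, ← cfc_mul _ _ C]
    refine cfc_mono fun x hx => ?_
    rcases le_total x (-7 / 8) with hx' | hx'
    · simp [plateau_eq_one hx']
    · have := ramp_lower hx' (abs_le_one_of_mem_spectrum hC hk hsum hx).2
      nlinarith [mul_nonneg (sub_nonneg.2 this) (mul_self_nonneg (1 - plateau x))]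
  have h2 : B * (h * h) * B ≤ (1 / 36 : ℝ) • (B * B) := by
    have e1 : B * (h * h) * B = cfc (fun x => b x * (x * x) * b x) h := by
      rw [cfc_mul (fun x => b x * (x * x)) b h, cfc_mul b (fun x => x * x) h,
        cfc_mul (fun x => x) (fun x => x) h, cfc_id' ℝ h]
    have e2 : (1 / 36 : ℝ) • (B * B) = cfc (fun x => 1 / 36 * (b x * b x)) h := by
      rw [cfc_const_mul _ (fun x => b x * b x) h, cfc_mul b b h]
    rw [e1, e2]
    refine cfc_mono fun x _ => ?_
    rcases le_total (1 / 6) |x| with hx | hx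
    · simp [hb0 x hx]
    · have hxx : x * x ≤ 1 / 36 := by
        rw [← abs_mul_abs_self]; nlinarith [abs_nonneg x]
      nlinarith [mul_nonneg (sub_nonneg.2 hxx) (mul_self_nonneg (b x))]
  have h3 := hBs.conjugate_le_conjugate h1
  have h4 := hDs.conjugate_le_conjugate h2
  have e3 : B * (D * (h * h) * D) * B = D * (B * (h * h) * B) * D := by
    calc B * (D * (h * h) * D) * B = (B * D) * (h * h) * (D * B) := by noncomm_ring
      _ = (D * B) * (h * h) * (B * D) := by rw [hDB.eq]
      _ = _ := by noncomm_ring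
  have e4 : D * ((1 / 36 : ℝ) • (B * B)) * D = (1 / 36 : ℝ) • (star (D * B) * (D * B)) := by
    rw [star_mul, hDs.star_eq, hBs.star_eq, mul_smul_comm, smul_mul_assoc]
    congr 1
    calc D * (B * B) * D = (D * B) * (B * D) := by noncomm_ring
      _ = (B * D) * (D * B) := by rw [hDB.eq]
  have e5 : B * ((1 / 16 : ℝ) • (D * D)) * B = (1 / 16 : ℝ) • (star (D * B) * (D * B)) := by
    rw [star_mul, hDs.star_eq, hBs.star_eq, mul_smul_comm, smul_mul_assoc]
    congr 1
    noncomm_ring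
  have h5 : (1 / 16 : ℝ) • (star (D * B) * (D * B)) ≤ (1 / 36 : ℝ) • (star (D * B) * (D * B)) := by
    rw [← e4, ← e5]
    exact h3.trans (e3.trans_le h4)
  have h6 : (1 / 16 - 1 / 36 : ℝ) • (star (D * B) * (D * B)) ≤ 0 := by
    rw [sub_smul]; exact sub_nonpos.2 h5
  have h7 : star (D * B) * (D * B) = 0 := by
    refine le_antisymm ?_ (star_mul_self_nonneg _)
    have := smul_le_smul_of_nonneg_left h6 (by norm_num : (0 : ℝ) ≤ (1 / 16 - 1 / 36 : ℝ)⁻¹)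
    rwa [smul_smul, inv_mul_cancel₀ (by norm_num), one_smul, smul_zero] at this
  rw [CStarRing.star_mul_self_eq_zero_iff, hD, sub_mul, one_mul, sub_eq_zero] at h7
  exact h7.symm

theorem mul_cfc_glue {C k J : A} (hC : IsSelfAdjoint C) (hk : IsSelfAdjoint k)
    (hCk : Commute C k) (hsum : C * C + k * k = 1) (hJ : IsSelfAdjoint J)
    (hle : cfc (fun x => 1 - x * x + ramp x * (x - 1 / 250) * ramp x) C
      ≤ glue C k J * glue C k J)
    {b : ℝ → ℝ} (hb : Continuous b) (hb0 : ∀ x, 1 / 6 ≤ |x| → b x = 0) :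
    k * cfc b (glue C k J) = cfc (fun x => x * b x) (glue C k J) := by
  have hs : IsSelfAdjoint (glue C k J) := isSelfAdjoint_glue hk hJ
  have hfB := plateau_mul_cfc_glue hC hk hCk hsum hJ hle hb hb0
  rw [cfc_mul (fun x => x) b (glue C k J), cfc_id' ℝ (glue C k J), ← hfB, ← mul_assoc, ← mul_assoc,
    glue_mul_plateau]

theorem realPart_mul_cfc_glue {C k J : A} (hC : IsSelfAdjoint C) (hk : IsSelfAdjoint k)
    (hCk : Commute C k) (hsum : C * C + k * k = 1) (hJ : IsSelfAdjoint J)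
    (hle : cfc (fun x => 1 - x * x + ramp x * (x - 1 / 250) * ramp x) C
      ≤ glue C k J * glue C k J)
    {b : ℝ → ℝ} (hb : Continuous b) (hb0 : ∀ x, 1 / 6 ≤ |x| → b x = 0) (hbn : ∀ x, 0 ≤ b x) :
    C * cfc b (glue C k J) = -cfc (fun x => √(1 - x * x) * b x) (glue C k J) := by
  have hfB := plateau_mul_cfc_glue hC hk hCk hsum hJ hle hb hb0
  have hkB := mul_cfc_glue hC hk hCk hsum hJ hle hb hb0
  have hkk := mul_cfc_glue hC hk hCk hsum hJ hle (b := fun x => x * b x) (by fun_prop)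
    (fun x hx => by simp [hb0 x hx])
  set h := glue C k J with hh
  have hs : IsSelfAdjoint h := isSelfAdjoint_glue hk hJ
  set f := cfc plateau C with hf
  set B := cfc b h with hB
  have hBs : IsSelfAdjoint B := cfc_predicate b h
  have hCf : Commute C f := (Commute.refl C).cfc_real plateau |>.symm
  have hCfh : Commute h (C * f) := by
    calc h * (C * f) = (h * f) * C := by rw [hCf.eq, mul_assoc]
      _ = k * (C * f) := by rw [hh, hf, glue_mul_plateau, ← hf, mul_assoc, hCf.eq]
      _ = C * (f * h) := by rw [hh, hf, plateau_mul_glue J hCk, ← mul_assoc, ← mul_assoc, hCk.eq]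
      _ = C * f * h := by rw [mul_assoc]
  have hCB : C * B = C * f * B := by rw [mul_assoc, hfB]
  have hcomm : Commute B (C * f) := hCfh.cfc_real b
  have hN : 0 ≤ -(C * f) := by
    have : -(C * f) = cfc (fun x => -(x * plateau x)) C := by
      rw [cfc_neg (fun x => x * plateau x) C, cfc_mul (fun x => x) plateau C, cfc_id' ℝ C]
    rw [this]
    exact cfc_nonneg fun x _ => neg_nonneg.2 (plateau_mul_nonpos x)
  have hBn : 0 ≤ B := cfc_nonneg fun x _ => hbn x
  have hpos : 0 ≤ -(C * B) := by
    rw [hCB, ← neg_mul]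
    exact Commute.mul_nonneg hN hBn hcomm.neg_right.symm
  have hCBcomm : C * B = B * C := by
    have : IsSelfAdjoint (C * B) := by
      simpa using (IsSelfAdjoint.of_nonneg hpos).neg
    rw [← this.star_eq, star_mul, hC.star_eq, hBs.star_eq]
  -- The positive element `-(C * B)` is identified through its square, which `C² = 1 - k²` turns
  -- into a function of `h`.
  have hsq : -(C * B) * -(C * B)
      = cfc (fun x => √(1 - x * x) * b x) h * cfc (fun x => √(1 - x * x) * b x) h := by
    have e1 : -(C * B) * -(C * B) = (B - k * (k * B)) * B := by
      calc -(C * B) * -(C * B) = C * (B * C) * B := by noncomm_ring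
        _ = (C * C) * B * B := by rw [← hCBcomm]; noncomm_ring
        _ = (1 - k * k) * B * B := by rw [← hsum]; noncomm_ring
        _ = _ := by noncomm_ring
    rw [e1, hkB, hkk, hB, ← cfc_sub b (fun x => x * (x * b x)) h, ← cfc_mul _ b h,
      ← cfc_mul _ _ h]
    congr 1
    ext x
    rcases le_total (1 / 6) |x| with hx | hx
    · simp [hb0 x hx]
    · have hxx : 0 ≤ 1 - x * x := by
        rw [← abs_mul_abs_self]; nlinarith [abs_nonneg x]
      have := Real.mul_self_sqrt hxx
      linear_combination (-(b x * b x)) * this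
  have hR : 0 ≤ cfc (fun x => √(1 - x * x) * b x) h :=
    cfc_nonneg fun x _ => mul_nonneg (Real.sqrt_nonneg _) (hbn x)
  rw [← CFC.sqrt_unique rfl hR, ← hsq, CFC.sqrt_unique rfl hpos, neg_neg]

end Localization

/-! ### Patching a unitary near `-1` -/

section Perturbation

variable {A : Type u} [CStarAlgebra A]

/-- Spectra of elements close to `a` lie in one compact ball, on which `φ` may be controlled
uniformly. -/
theorem continuous_cfc_selfAdjoint {φ : ℝ → ℝ} (hφ : Continuous φ) :
    Continuous fun a : selfAdjoint A => cfc φ (a : A) := by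
  rcases subsingleton_or_nontrivial A with hA | hA
  · exact continuous_of_const fun _ _ => Subsingleton.elim _ _
  refine Continuous.cfc (s := fun a => Metric.closedBall 0 (‖a‖ + 1)) φ continuous_subtype_val
    (fun a => isCompact_closedBall _ _) (fun a => ?_) (fun a => hφ.continuousOn) (fun a => a.2)
  filter_upwards [Metric.ball_mem_nhds a one_pos] with c hc x hx
  have h1 : ‖x‖ ≤ ‖(c : A)‖ := spectrum.norm_le_norm_of_mem hx
  have h2 : ‖c‖ ≤ ‖a‖ + 1 := by
    rw [Metric.mem_ball, dist_eq_norm] at hc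
    linarith [norm_sub_norm_le c a]
  rw [mem_closedBall_zero_iff]
  exact h1.trans h2

/-- A continuous function equal to `1` on `|x| ≤ 1/12` and vanishing on `1/6 ≤ |x|`. -/
noncomputable def bump (x : ℝ) : ℝ := max 0 (min 1 (2 - 12 * |x|))

/-- The function `1 - (1 - bump) ^ 2`. -/
noncomputable def bumpTwo (x : ℝ) : ℝ := 2 * bump x - bump x * bump x

/-- The tent function of height one supported on `|x| ≤ 1/12`. -/
noncomputable def tent (x : ℝ) : ℝ := max 0 (1 - 12 * |x|)

@[fun_prop]
theorem continuous_bump : Continuous bump := by unfold bump; fun_prop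

@[fun_prop]
theorem continuous_bumpTwo : Continuous bumpTwo := by unfold bumpTwo; fun_prop

@[fun_prop]
theorem continuous_tent : Continuous tent := by unfold tent; fun_prop

theorem bump_nonneg (x : ℝ) : 0 ≤ bump x := le_max_left _ _

theorem bump_le_one (x : ℝ) : bump x ≤ 1 := max_le zero_le_one (min_le_left _ _)

theorem bump_eq_zero {x : ℝ} (hx : 1 / 6 ≤ |x|) : bump x = 0 :=
  max_eq_left ((min_le_right _ _).trans (by linarith))

theorem bump_eq_one {x : ℝ} (hx : |x| ≤ 1 / 12) : bump x = 1 := by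
  rw [bump, min_eq_left (by linarith), max_eq_right zero_le_one]

theorem bumpTwo_nonneg (x : ℝ) : 0 ≤ bumpTwo x := by
  have := bump_nonneg x
  have := bump_le_one x
  unfold bumpTwo; nlinarith

theorem bumpTwo_eq_zero {x : ℝ} (hx : 1 / 6 ≤ |x|) : bumpTwo x = 0 := by
  simp [bumpTwo, bump_eq_zero hx]

theorem tent_eq_zero {x : ℝ} (hx : 1 / 12 ≤ |x|) : tent x = 0 := max_eq_left (by linarith)

/-- The model near `-1` of a unitary with imaginary part `a`, cut off by `g`. -/
noncomputable def model (g : ℝ → ℝ) (a : A) : A :=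
  -cfc (fun x => √(1 - x * x) * g x) a + Complex.I • cfc (fun x => x * g x) a

theorem star_model (g : ℝ → ℝ) (a : A) : star (model g a) =
    -cfc (fun x => √(1 - x * x) * g x) a - Complex.I • cfc (fun x => x * g x) a := by
  have h1 : IsSelfAdjoint (cfc (fun x => √(1 - x * x) * g x) a) := cfc_predicate _ a
  have h2 : IsSelfAdjoint (cfc (fun x => x * g x) a) := cfc_predicate _ a
  rw [model, star_add, star_neg, star_smul, h1.star_eq, h2.star_eq]
  simp [sub_eq_add_neg]

/-- The element obtained from `u` by replacing its part near `-1` by the model built from `a`. -/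
noncomputable def patch (u a : A) : A :=
  (1 - cfc bump a) * u * (1 - cfc bump a) + model bumpTwo a

theorem continuous_patch (u : A) : Continuous fun a : selfAdjoint A => patch u (a : A) := by
  have h1 := continuous_cfc_selfAdjoint (A := A) continuous_bump
  have h2 := continuous_cfc_selfAdjoint (A := A)
    (φ := fun x => √(1 - x * x) * bumpTwo x) (by fun_prop)
  have h3 := continuous_cfc_selfAdjoint (A := A) (φ := fun x => x * bumpTwo x) (by fun_prop)
  unfold patch model
  fun_prop

theorem cfc_mul_cfc_eq {a : A} {φ ψ χ : ℝ → ℝ} (hφ : Continuous φ)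
    (hψ : Continuous ψ) (h : ∀ x, φ x * ψ x = χ x) : cfc φ a * cfc ψ a = cfc χ a := by
  rw [← cfc_mul φ ψ a]
  congr 1
  exact funext h

theorem one_sub_bump_mul_cfc {a : A} {g : ℝ → ℝ} (hg : Continuous g)
    (hg0 : ∀ x, 1 / 12 ≤ |x| → g x = 0) : (1 - cfc bump a) * cfc g a = 0 := by
  rw [sub_mul, one_mul, sub_eq_zero, cfc_mul_cfc_eq continuous_bump hg]
  intro x
  rcases le_total (1 / 12) |x| with hx | hx
  · simp [hg0 x hx]
  · simp [bump_eq_one hx]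

theorem bumpTwo_mul_of_support {g : ℝ → ℝ} (hg0 : ∀ x, 1 / 12 ≤ |x| → g x = 0) (x : ℝ) :
    bumpTwo x * g x = g x := by
  rcases le_total (1 / 12) |x| with hx | hx
  · simp [hg0 x hx]
  · simp only [bumpTwo, bump_eq_one hx]; ring

theorem patch_mul_cfc (u a : A) {g : ℝ → ℝ} (hg : Continuous g)
    (hg0 : ∀ x, 1 / 12 ≤ |x| → g x = 0) : patch u a * cfc g a = model g a := by
  rw [patch, add_mul, mul_assoc, one_sub_bump_mul_cfc hg hg0, mul_zero, zero_add, model, model,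
    add_mul, neg_mul, smul_mul_assoc,
    cfc_mul_cfc_eq (χ := fun x => √(1 - x * x) * g x) (by fun_prop) hg,
    cfc_mul_cfc_eq (χ := fun x => x * g x) (by fun_prop) hg]
  · intro x; rw [mul_assoc, bumpTwo_mul_of_support hg0]
  · intro x; rw [mul_assoc, bumpTwo_mul_of_support hg0]

theorem star_patch_mul_cfc (u a : A) {g : ℝ → ℝ} (hg : Continuous g)
    (hg0 : ∀ x, 1 / 12 ≤ |x| → g x = 0) : star (patch u a) * cfc g a = star (model g a) := by
  have hB : IsSelfAdjoint (1 - cfc bump a) := (IsSelfAdjoint.one A).sub (cfc_predicate bump a)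
  rw [patch, star_add, star_mul, star_mul, hB.star_eq, add_mul, mul_assoc, mul_assoc,
    one_sub_bump_mul_cfc hg hg0, mul_zero, mul_zero, zero_add, star_model, star_model,
    sub_mul, neg_mul, smul_mul_assoc,
    cfc_mul_cfc_eq (χ := fun x => √(1 - x * x) * g x) (by fun_prop) hg,
    cfc_mul_cfc_eq (χ := fun x => x * g x) (by fun_prop) hg]
  · intro x; rw [mul_assoc, bumpTwo_mul_of_support hg0]
  · intro x; rw [mul_assoc, bumpTwo_mul_of_support hg0]

/-- On the support of `g` the bump is `1`, so only the model survives, and it is unitary there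
because `(1 - x²) + x² = 1`. -/
theorem star_patch_mul_patch_mul_cfc (u a : A) {g : ℝ → ℝ} (hg : Continuous g)
    (hg0 : ∀ x, 1 / 12 ≤ |x| → g x = 0) :
    star (patch u a) * patch u a * cfc g a = cfc g a := by
  have h1 := star_patch_mul_cfc u a (g := fun x => √(1 - x * x) * g x) (by fun_prop)
    (fun x hx => by simp [hg0 x hx])
  have h2 := star_patch_mul_cfc u a (g := fun x => x * g x) (by fun_prop)
    (fun x hx => by simp [hg0 x hx])
  rw [mul_assoc, patch_mul_cfc u a hg hg0, model, mul_add, mul_neg, mul_smul_comm, h1, h2,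
    star_model, star_model]
  have e1 : cfc (fun x => √(1 - x * x) * (x * g x)) a
      = cfc (fun x => x * (√(1 - x * x) * g x)) a := by
    congr 1; ext x; ring
  have e2 : cfc (fun x => √(1 - x * x) * (√(1 - x * x) * g x)) a + cfc (fun x => x * (x * g x)) a
      = cfc g a := by
    rw [← cfc_add a (fun x => √(1 - x * x) * (√(1 - x * x) * g x)) (fun x => x * (x * g x))]
    congr 1
    ext x
    rcases le_total (1 / 12) |x| with hx | hx
    · simp [hg0 x hx]
    · have hxx : 0 ≤ 1 - x * x := by
        rw [← abs_mul_abs_self]; nlinarith [abs_nonneg x]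
      have := Real.mul_self_sqrt hxx
      linear_combination (g x) * this
  rw [e1, ← e2, smul_sub, smul_neg, smul_smul, Complex.I_mul_I, neg_smul, one_smul]
  abel

/-- The unitary commutes with `B = bump(h)` and equals the model where `bumpTwo` lives; the weights
`(1 - B)²` and `1 - (1 - B)²` add up to `1`. -/
theorem patch_self {C k h : A} (hC : IsSelfAdjoint C) (hk : IsSelfAdjoint k)
    (hkb : ∀ b : ℝ → ℝ, Continuous b → (∀ x, 1 / 6 ≤ |x| → b x = 0) →
      k * cfc b h = cfc (fun x => x * b x) h)
    (hCb : ∀ b : ℝ → ℝ, Continuous b → (∀ x, 1 / 6 ≤ |x| → b x = 0) → (∀ x, 0 ≤ b x) →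
      C * cfc b h = -cfc (fun x => √(1 - x * x) * b x) h) :
    patch (C + Complex.I • k) h = C + Complex.I • k := by
  set B := cfc bump h with hB
  have hBs : IsSelfAdjoint B := cfc_predicate bump h
  have hk1 := hkb bump continuous_bump fun x => bump_eq_zero
  have hC1 := hCb bump continuous_bump (fun x => bump_eq_zero) bump_nonneg
  have hk2 := hkb bumpTwo continuous_bumpTwo fun x => bumpTwo_eq_zero
  have hC2 := hCb bumpTwo continuous_bumpTwo (fun x => bumpTwo_eq_zero) bumpTwo_nonneg
  have hBk : B * k = k * B := by
    have : IsSelfAdjoint (k * B) := by rw [hk1]; exact cfc_predicate _ h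
    rw [← this.star_eq, star_mul, hk.star_eq, hBs.star_eq]
  have hBC : B * C = C * B := by
    have : IsSelfAdjoint (C * B) := by
      rw [hC1]; exact IsSelfAdjoint.neg (cfc_predicate _ h)
    rw [← this.star_eq, star_mul, hC.star_eq, hBs.star_eq]
  have hm : cfc bumpTwo h = (2 : ℝ) • B - B * B := by
    rw [hB, ← cfc_const_mul 2 bump h, ← cfc_mul bump bump h,
      ← cfc_sub (fun x => 2 * bump x) (fun x => bump x * bump x) h]
    rfl
  set w := C + Complex.I • k with hw
  have hBw : B * w = w * B := by
    rw [hw, mul_add, add_mul, mul_smul_comm, smul_mul_assoc, hBk, hBC]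
  have hwm : w * cfc bumpTwo h = model bumpTwo h := by
    rw [hw, add_mul, smul_mul_assoc, hk2, hC2, model]
  rw [patch, ← hwm, hm]
  calc (1 - B) * w * (1 - B) + w * ((2 : ℝ) • B - B * B)
      = w - B * w - w * B + (B * w) * B + w * ((2 : ℝ) • B - B * B) := by noncomm_ring
    _ = w := by rw [hBw, two_smul]; noncomm_ring

end Perturbation

/-! ### Unitary part of an element close to a unitary -/

section Polar

variable {A : Type u} [CStarAlgebra A] [PartialOrder A] [StarOrderedRing A]

/-- A polar decomposition: an element close to a unitary has a unitary part, which agrees with it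
wherever it acts isometrically. -/
theorem exists_unitary_near {z : A} {w : unitary A} {ε : ℝ} (hε : ε ≤ 1 / 4)
    (hz : ‖z - w‖ ≤ ε) : ∃ (v : unitary A) (R : A), (v : A) = z * R ∧ IsSelfAdjoint R ∧
      (∀ B, star z * z * B = B → R * B = B) ∧ ‖(v - w : A)‖ ≤ 4 * ε := by
  rcases subsingleton_or_nontrivial A with hA | hA
  · exact ⟨w, 1, Subsingleton.elim _ _, IsSelfAdjoint.one A, fun _ _ => Subsingleton.elim _ _,
      by simpa using (norm_nonneg _).trans hz⟩
  have hε0 : 0 ≤ ε := (norm_nonneg _).trans hz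
  set Y := star z * z with hY
  have hY0 : 0 ≤ Y := star_mul_self_nonneg z
  have hw1 : ‖(w : A)‖ = 1 := CStarRing.norm_coe_unitary w
  have hzn : ‖z‖ ≤ 1 + ε := by
    calc ‖z‖ = ‖(z - w) + w‖ := by rw [sub_add_cancel]
      _ ≤ ε + 1 := (norm_add_le _ _).trans (by rw [hw1]; linarith)
      _ = 1 + ε := add_comm _ _
  have hY1 : ‖1 - Y‖ ≤ 3 * ε := by
    have e : Y - 1 = star (z - w) * z + star (w : A) * (z - w) := by
      have : star (w : A) * w = 1 := Unitary.coe_star_mul_self w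
      rw [hY, ← this, star_sub]; noncomm_ring
    rw [norm_sub_rev, e]
    calc ‖star (z - w) * z + star (w : A) * (z - w)‖
        ≤ ‖z - w‖ * ‖z‖ + ‖(w : A)‖ * ‖z - w‖ := by
          refine (norm_add_le _ _).trans (add_le_add ?_ ?_)
          · exact (norm_mul_le _ _).trans_eq (by rw [norm_star])
          · exact (norm_mul_le _ _).trans_eq (by rw [norm_star])
      _ ≤ ε * (1 + ε) + 1 * ε := by rw [hw1]; gcongr
      _ ≤ 3 * ε := by nlinarith
  set Q := CFC.sqrt Y with hQ
  have hQ0 : 0 ≤ Q := CFC.sqrt_nonneg Y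
  have hQs : IsSelfAdjoint Q := .of_nonneg hQ0
  have hQQ : Q * Q = Y := CFC.sqrt_mul_sqrt_self Y hY0
  -- For `x ≥ 0` one has `|1 - x| ≤ |1 - x²|`, so passing to the square root costs nothing.
  have hQ1 : ‖1 - Q‖ ≤ 3 * ε := by
    refine le_trans ?_ hY1
    have e1 : 1 - Q = cfc (fun x : ℝ => 1 - x) Q := by
      rw [cfc_sub (fun _ => 1) (fun x => x) Q, cfc_const_one ℝ Q, cfc_id' ℝ Q]
    have e2 : 1 - Y = cfc (fun x : ℝ => 1 - x * x) Q := by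
      rw [cfc_sub (fun _ => 1) (fun x => x * x) Q, cfc_const_one ℝ Q,
        cfc_mul (fun x => x) (fun x => x) Q, cfc_id' ℝ Q, hQQ]
    rw [e1, e2]
    refine norm_cfc_le (norm_nonneg _) fun x hx => ?_
    refine le_trans ?_ (norm_apply_le_norm_cfc (fun x : ℝ => 1 - x * x) Q hx)
    have hx0 : 0 ≤ x := spectrum_nonneg_of_nonneg hQ0 hx
    rw [Real.norm_eq_abs, Real.norm_eq_abs, show 1 - x * x = (1 - x) * (1 + x) by ring, abs_mul]
    exact le_mul_of_one_le_right (abs_nonneg _) (by rw [abs_of_nonneg] <;> linarith)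
  have hQu : IsUnit Q := by
    have : ‖1 - Q‖ < 1 := hQ1.trans_lt (by linarith)
    simpa using isUnit_one_sub_of_norm_lt_one this
  obtain ⟨q, hq⟩ := hQu
  set R : A := ↑q⁻¹ with hR
  have hRQ : R * Q = 1 := by rw [← hq]; exact q.inv_mul
  have hQR : Q * R = 1 := by rw [← hq]; exact q.mul_inv
  have hRs : IsSelfAdjoint R := by
    have h1 : star R * Q = 1 := by
      rw [← hQs.star_eq, ← star_mul, hQR, star_one]
    calc star R = star R * (Q * R) := by rw [hQR, mul_one]
      _ = R := by rw [← mul_assoc, h1, one_mul]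
  have hzu : IsUnit z := by
    have h1 : ‖1 - star (w : A) * z‖ < 1 := by
      have : 1 - star (w : A) * z = star (w : A) * (w - z) := by
        rw [mul_sub, Unitary.coe_star_mul_self]
      rw [this]
      refine (norm_mul_le _ _).trans_lt ?_
      rw [norm_star, hw1, one_mul, norm_sub_rev]
      linarith
    have h2 : IsUnit (star (w : A) * z) := by simpa using isUnit_one_sub_of_norm_lt_one h1
    have h3 : IsUnit (w : A) := (Unitary.toUnits w).isUnit
    have : z = w * (star (w : A) * z) := by
      rw [← mul_assoc, Unitary.mul_star_self_of_mem w.2, one_mul]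
    rw [this]
    exact h3.mul h2
  have hv1 : star (z * R) * (z * R) = 1 := by
    calc star (z * R) * (z * R) = R * (star z * z) * R := by
          rw [star_mul, hRs.star_eq]; noncomm_ring
      _ = (R * Q) * (Q * R) := by rw [← hY, ← hQQ]; noncomm_ring
      _ = 1 := by rw [hRQ, hQR, mul_one]
  have hvu : IsUnit (z * R) := hzu.mul (q⁻¹).isUnit
  have hv2 : (z * R) * star (z * R) = 1 := by
    obtain ⟨y, hy⟩ := hvu
    rw [← hy] at hv1 ⊢
    have h1 : star (y : A) = ↑y⁻¹ := by
      calc star (y : A) = star (y : A) * (y * ↑y⁻¹) := by rw [y.mul_inv, mul_one]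
        _ = ↑y⁻¹ := by rw [← mul_assoc, hv1, one_mul]
    rw [h1, y.mul_inv]
  let v : unitary A := ⟨z * R, Unitary.mem_iff.2 ⟨hv1, hv2⟩⟩
  refine ⟨v, R, rfl, hRs, fun B hB => ?_, ?_⟩
  · have h1 : (1 + Q) * (Q * B - B) = 0 := by
      calc (1 + Q) * (Q * B - B) = (Q * Q) * B - B := by noncomm_ring
        _ = 0 := by rw [hQQ, hB, sub_self]
    have h2 : IsUnit (1 + Q) := by
      refine CStarAlgebra.isUnit_of_le (1 : A) (le_add_of_nonneg_right hQ0) ?_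
      exact IsStrictlyPositive.iff_of_unital.2 ⟨zero_le_one, isUnit_one⟩
    have h3 : Q * B = B := sub_eq_zero.1 ((h2.mul_right_eq_zero).1 h1)
    calc R * B = R * (Q * B) := by rw [h3]
      _ = B := by rw [← mul_assoc, hRQ, one_mul]
  · have h1 : (v - w : A) = -((v : A) * (Q - 1)) + (z - w) := by
      have : (v : A) * Q = z := by
        change z * R * Q = z
        rw [mul_assoc, hRQ, mul_one]
      rw [mul_sub, this]; noncomm_ring
    rw [h1]
    calc ‖-((v : A) * (Q - 1)) + (z - w)‖ ≤ ‖Q - 1‖ + ‖z - w‖ := by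
          refine (norm_add_le _ _).trans (add_le_add_left ?_ _)
          rw [norm_neg, CStarRing.norm_coe_unitary_mul]
      _ ≤ 3 * ε + ε := by rw [norm_sub_rev Q 1]; gcongr
      _ = 4 * ε := by ring

end Polar

/-! ### The patched unitary avoids `-1` -/

section Gap

variable {A : Type u} [CStarAlgebra A]

/-- The constant error `1/20000` is harmless near `0` because `(1 - tent)²` vanishes quadratically
there; where the tent is zero, `x²` is at least `1/144` and absorbs it. -/
theorem tent_bound (x : ℝ) : x * x / 50 ≤
    2 * (1 - √(1 - x * x)) * tent x * tent x + 2 * (2 * (1 - √(1 - x * x)) * tent x * (1 - tent x))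
      + (1 - tent x) * (x * x / 10 - 1 / 20000) * (1 - tent x) := by
  rcases le_total (1 / 12) |x| with hx | hx
  · have hxx : 1 / 144 ≤ x * x := by
      rw [← abs_mul_abs_self]; nlinarith
    simp only [tent_eq_zero hx]
    linarith
  · have hxx : x * x ≤ 1 / 144 := by
      rw [← abs_mul_abs_self]; nlinarith [abs_nonneg x]
    have h0 := abs_nonneg x
    have ht : tent x = 1 - 12 * |x| := max_eq_right (by linarith)
    have hs : √(1 - x * x) ≤ 1 - x * x / 2 := by
      rw [Real.sqrt_le_left (by nlinarith)]
      nlinarith [mul_self_nonneg (x * x)]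
    have h1 : x * x ≤ 2 * (1 - √(1 - x * x)) := by linarith
    set s := 2 * (1 - √(1 - x * x))
    rw [ht, ← abs_mul_abs_self x] at *
    set y := |x|
    have h2 : y * y * ((1 - 12 * y) * (1 + 12 * y)) ≤ s * ((1 - 12 * y) * (1 + 12 * y)) :=
      mul_le_mul_of_nonneg_right h1 (mul_nonneg (by linarith) (by linarith))
    nlinarith [mul_nonneg (mul_nonneg h0 h0) (mul_nonneg h0 h0), mul_nonneg h0 h0,
      mul_nonneg (mul_nonneg h0 h0) h0]

/-- Expand `X = Xg + gX - gXg + (1 - g)X(1 - g)` with `g = tent(a)`: knowing `Xg` determines all but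
the last term. -/
theorem cfc_add_mul_mul_cfc_add {X a : A} (hX : IsSelfAdjoint X)
    (hXt : X * cfc tent a = cfc (fun x => 2 * (1 - √(1 - x * x)) * tent x) a) :
    X = cfc (fun x => 2 * (1 - √(1 - x * x)) * tent x * tent x
        + 2 * (2 * (1 - √(1 - x * x)) * tent x * (1 - tent x))) a
      + (1 - cfc tent a) * X * (1 - cfc tent a) := by
  set g := cfc tent a with hg
  have hgs : IsSelfAdjoint g := cfc_predicate tent a
  set T := cfc (fun x => 2 * (1 - √(1 - x * x)) * tent x) a with hT
  have hTs : IsSelfAdjoint T := cfc_predicate _ a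
  have hgX : g * X = T := by
    rw [← hTs.star_eq, ← hXt, star_mul, hX.star_eq, hgs.star_eq]
  have hgT : T * g = g * T := by rw [← hgX, mul_assoc, hXt, hgX]
  have e : cfc (fun x => 2 * (1 - √(1 - x * x)) * tent x * tent x
      + 2 * (2 * (1 - √(1 - x * x)) * tent x * (1 - tent x))) a = (2 : ℝ) • T - T * g := by
    rw [hT, hg, ← cfc_const_mul 2 _ a, ← cfc_mul _ tent a,
      ← cfc_sub (fun x => 2 * (2 * (1 - √(1 - x * x)) * tent x)) _ a]
    congr 1
    ext x
    ring
  rw [e]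
  calc X = X * g + g * X - (g * X) * g + (1 - g) * X * (1 - g) := by noncomm_ring
    _ = _ := by rw [hXt, hgX, two_smul]

/-- The element factors as `(1 + v)(1 + v*)` with commuting factors, and distance less than `2` from
`1` means that `-1` is not in the spectrum. -/
theorem norm_sub_one_lt_two_of_isUnit {v : unitary A} (h : IsUnit (2 + (v : A) + star (v : A) : A)) :
    ‖(v - 1 : A)‖ < 2 := by
  rw [Unitary.norm_sub_one_lt_two_iff v.2, spectrum.notMem_iff]
  have h1 : (v : A) * star (v : A) = 1 := Unitary.mul_star_self_of_mem v.2
  have h2 : star (v : A) * (v : A) = 1 := Unitary.star_mul_self_of_mem v.2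
  have hc : Commute (1 + v : A) (1 + star (v : A) : A) := by
    change (1 + v : A) * (1 + star (v : A) : A) = (1 + star (v : A) : A) * (1 + v : A)
    rw [add_mul, add_mul, mul_add, mul_add, mul_add, mul_add, h1, h2]
    noncomm_ring
  have e : (2 + v + star (v : A) : A) = (1 + v : A) * (1 + star (v : A) : A) := by
    rw [add_mul, mul_add, mul_add, h1, one_mul, one_mul, mul_one, ← one_add_one_eq_two]
    abel
  rw [e, hc.isUnit_mul_iff] at h
  have : algebraMap ℂ A (-1) - v = -(1 + v) := by rw [map_neg, map_one]; abel
  rw [this]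
  exact h.1.neg

variable [PartialOrder A] [StarOrderedRing A]

theorem isUnit_of_local_bounds {X a : A} (ha : IsSelfAdjoint a) (hau : IsUnit a)
    (hX : IsSelfAdjoint X)
    (hXt : X * cfc tent a = cfc (fun x => 2 * (1 - √(1 - x * x)) * tent x) a)
    (hle : cfc (fun x : ℝ => x * x / 10 - 1 / 20000) a ≤ X) : IsUnit X := by
  have h1 : cfc (fun x : ℝ => x * x / 50) a ≤ X := by
    rw [cfc_add_mul_mul_cfc_add hX hXt]
    have hq : IsSelfAdjoint (1 - cfc tent a) := (IsSelfAdjoint.one A).sub (cfc_predicate tent a)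
    refine le_trans ?_ (add_le_add_right (hq.conjugate_le_conjugate hle) _)
    have eq : 1 - cfc tent a = cfc (fun x => 1 - tent x) a := by
      rw [cfc_sub (fun _ => 1) tent a, cfc_const_one ℝ a]
    rw [eq, ← cfc_mul _ _ a, ← cfc_mul _ _ a, ← cfc_add a _ _]
    exact cfc_mono fun x _ => tent_bound x
  refine CStarAlgebra.isUnit_of_le _ h1 (IsStrictlyPositive.iff_of_unital.2 ⟨?_, ?_⟩)
  · exact cfc_nonneg fun x _ => div_nonneg (mul_self_nonneg x) (by norm_num)
  · rw [isUnit_cfc_iff (fun x : ℝ => x * x / 50) a]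
    intro x hx hx0
    have : x = 0 := by simpa using hx0
    rw [this] at hx
    exact (spectrum.zero_notMem_iff ℝ).2 hau hx

/-- If the position element `h` of `w` near `-1` is close to an invertible `a`, then the patched
unitary avoids `-1`. -/
theorem exists_unitary_of_patch {w : unitary A} {C k h a : A} {ε : ℝ}
    (hw : (w : A) = C + Complex.I • k) (hC : IsSelfAdjoint C) (hk : IsSelfAdjoint k)
    (hh : h * h ≤ (20 : ℝ) • (1 + C)) (hhs : IsSelfAdjoint h)
    (ha : IsSelfAdjoint a) (hau : IsUnit a)
    (hha : ‖h * h - a * a‖ ≤ 1 / 10000) (hε : ε ≤ 1 / 400000) (hz : ‖patch (w : A) a - w‖ ≤ ε) :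
    ∃ v : unitary A, ‖(v - 1 : A)‖ < 2 ∧ ‖(v - w : A)‖ ≤ 4 * ε := by
  obtain ⟨v, R, hv, hRs, hR, hvw⟩ := exists_unitary_near (hε.trans (by norm_num)) hz
  refine ⟨v, norm_sub_one_lt_two_of_isUnit ?_, hvw⟩
  have ht0 : ∀ x, 1 / 12 ≤ |x| → tent x = 0 := fun x => tent_eq_zero
  have hRg : ∀ g : ℝ → ℝ, Continuous g → (∀ x, 1 / 12 ≤ |x| → g x = 0) →
      R * cfc g a = cfc g a := fun g hg hg0 => hR _ (star_patch_mul_patch_mul_cfc _ a hg hg0)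
  have hvt : (v : A) * cfc tent a = model tent a := by
    rw [hv, mul_assoc, hRg tent continuous_tent ht0, patch_mul_cfc _ a continuous_tent ht0]
  have hvt' : star (v : A) * cfc tent a = star (model tent a) := by
    rw [hv, star_mul, hRs.star_eq, mul_assoc, star_patch_mul_cfc _ a continuous_tent ht0,
      star_model, mul_sub, mul_neg, mul_smul_comm,
      hRg _ (by fun_prop) (fun x hx => by simp [ht0 x hx]),
      hRg _ (by fun_prop) (fun x hx => by simp [ht0 x hx])]
  have hXs : IsSelfAdjoint (2 + v + star (v : A) : A) := by
    rw [IsSelfAdjoint, star_add, star_add, star_star, star_ofNat]; abel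
  refine isUnit_of_local_bounds ha hau hXs ?_ ?_
  · rw [add_mul, add_mul, hvt, hvt', star_model, model]
    have : cfc (fun x => 2 * (1 - √(1 - x * x)) * tent x) a
        = (2 : ℝ) • cfc tent a - (2 : ℝ) • cfc (fun x => √(1 - x * x) * tent x) a := by
      rw [← cfc_const_mul 2 tent a, ← cfc_const_mul 2 (fun x => √(1 - x * x) * tent x) a,
        ← cfc_sub (fun x => 2 * tent x) (fun x => 2 * (√(1 - x * x) * tent x)) a]
      congr 1
      ext x
      ring
    rw [this, two_mul, two_smul, two_smul]
    abel
  · have e1 : cfc (fun x : ℝ => x * x / 10 - 1 / 20000) a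
        = (1 / 10 : ℝ) • (a * a) - algebraMap ℝ A (1 / 20000) := by
      rw [cfc_sub (fun x => x * x / 10) (fun _ => 1 / 20000) a, cfc_const (1 / 20000 : ℝ) a]
      congr 1
      simp only [div_eq_inv_mul, mul_one]
      rw [cfc_const_mul _ (fun x => x * x) a, cfc_mul (fun x => x) (fun x => x) a, cfc_id' ℝ a]
    have hsw : star (w : A) = C - Complex.I • k := by
      rw [hw, star_add, star_smul, hC.star_eq, hk.star_eq]
      simp [sub_eq_add_neg]
    have e2 : (2 : ℝ) • (1 + C) = 2 + w + star (w : A) := by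
      rw [hsw, hw, two_smul, ← one_add_one_eq_two]; abel
    have h1 : a * a ≤ h * h + algebraMap ℝ A (1 / 10000) := by
      have hs : IsSelfAdjoint (h * h - a * a) := by
        refine IsSelfAdjoint.sub ?_ ?_
        · simpa [hhs.star_eq] using IsSelfAdjoint.star_mul_self h
        · simpa [ha.star_eq] using IsSelfAdjoint.star_mul_self a
      have := (neg_le_neg (algebraMap_mono A hha)).trans
        (IsSelfAdjoint.neg_algebraMap_norm_le_self hs)
      rw [neg_le_sub_iff_le_add] at this
      exact this
    -- This is twice `4ε ≤ 1/100000`. With the tenth of `1/10000` coming from `h1`, the total error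
    -- is `3/100000`, below the `1/20000` allowed.
    have h2 : -algebraMap ℝ A (1 / 50000) ≤ (2 + v + star (v : A) : A) - (2 + w + star (w : A)) := by
      have e : (2 + v + star (v : A) : A) - (2 + w + star (w : A)) = (v - w) + star ((v : A) - w) := by
        rw [star_sub]; abel
      have hs : IsSelfAdjoint ((v - w) + star ((v : A) - w)) := by
        rw [IsSelfAdjoint, star_add, star_star, add_comm]
      have hn : ‖(v - w) + star ((v : A) - w)‖ ≤ 1 / 50000 := by
        refine (norm_add_le _ _).trans ?_
        rw [norm_star]
        linarith
      rw [e]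
      exact (neg_le_neg (algebraMap_mono A hn)).trans
        (IsSelfAdjoint.neg_algebraMap_norm_le_self hs)
    have h3 : (1 / 10 : ℝ) • (a * a)
        ≤ (2 + w + star (w : A)) + algebraMap ℝ A (1 / 100000) := by
      calc (1 / 10 : ℝ) • (a * a) ≤ (1 / 10 : ℝ) • ((20 : ℝ) • (1 + C)
            + algebraMap ℝ A (1 / 10000)) :=
            smul_le_smul_of_nonneg_left (h1.trans (add_le_add_left hh _)) (by norm_num)
        _ = (2 : ℝ) • (1 + C) + algebraMap ℝ A (1 / 100000) := by
            rw [smul_add, smul_smul, Algebra.algebraMap_eq_smul_one, smul_smul,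
              Algebra.algebraMap_eq_smul_one]
            norm_num
        _ = _ := by rw [e2]
    rw [e1, sub_le_iff_le_add]
    rw [neg_le_sub_iff_le_add] at h2
    calc (1 / 10 : ℝ) • (a * a) ≤ (2 + w + star (w : A)) + algebraMap ℝ A (1 / 100000) := h3
      _ ≤ (2 + v + star (v : A) : A) + algebraMap ℝ A (1 / 50000) + algebraMap ℝ A (1 / 100000) :=
          add_le_add_left h2 _
      _ = (2 + v + star (v : A) : A) + algebraMap ℝ A (3 / 100000) := by
          rw [add_assoc, ← map_add]; norm_num
      _ ≤ (2 + v + star (v : A) : A) + algebraMap ℝ A (1 / 20000) :=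
          add_le_add_right (algebraMap_mono A (by norm_num)) _

end Gap

/-! ### Real rank zero: the closure of the ball of radius `2` is clopen -/

section RealRankZero

open selfAdjoint Unitary
open scoped ComplexStarModule

variable {A : Type u} [CStarAlgebra A]

theorem coe_expUnitary_eq (a : selfAdjoint A) :
    (expUnitary a : A) = cfc Real.cos (a : A) + Complex.I • cfc Real.sin (a : A) := by
  have ha : IsSelfAdjoint (a : A) := a.2
  rw [expUnitary_coe, ← CFC.exp_eq_normedSpace_exp (𝕜 := ℂ), ← cfc_comp_smul Complex.I _ (a : A),
    cfc_real_eq_complex Real.cos ha, cfc_real_eq_complex Real.sin ha,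
    ← cfc_const_mul Complex.I _ (a : A), ← cfc_add (a : A) _ _]
  refine cfc_congr fun z hz => ?_
  have hz' : z = (z.re : ℂ) := ha.mem_spectrum_eq_re hz
  rw [hz']
  simp only [smul_eq_mul, ← Complex.exp_eq_exp_ℂ, Complex.ofReal_re]
  rw [mul_comm, Complex.exp_mul_I, Complex.ofReal_cos, Complex.ofReal_sin]
  ring

theorem realPart_mul_self_add (w : unitary A) :
    (ℜ (w : A) : A) * ℜ (w : A) + (ℑ (w : A) : A) * ℑ (w : A) = 1 ∧
      Commute (ℜ (w : A) : A) (ℑ (w : A) : A) := by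
  have h1 : star (w : A) * (w : A) = 1 := Unitary.star_mul_self_of_mem w.2
  have h2 : (w : A) * star (w : A) = 1 := Unitary.mul_star_self_of_mem w.2
  have hc : Commute (ℜ (w : A) : A) (ℑ (w : A) : A) := by
    have : IsStarNormal (w : A) := ⟨h1.trans h2.symm⟩
    exact (isStarNormal_iff_commute_realPart_imaginaryPart).1 this
  refine ⟨?_, hc⟩
  have hw := realPart_add_I_smul_imaginaryPart (w : A)
  set C : A := ((ℜ (w : A) : selfAdjoint A) : A)
  set k : A := ((ℑ (w : A) : selfAdjoint A) : A)
  have hC : IsSelfAdjoint C := (ℜ (w : A)).2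
  have hk : IsSelfAdjoint k := (ℑ (w : A)).2
  rw [← h1, ← hw, star_add, star_smul, hC.star_eq, hk.star_eq, add_mul, mul_add, mul_add,
    smul_mul_assoc, smul_mul_smul_comm, mul_smul_comm, hc.eq]
  simp

/-- In real rank zero, a unitary at distance less than `2` from `1` is close to a unitary `C + i k`
with a symmetry `J` that commutes with `C` and makes `k J` positive. -/
theorem exists_split_near (hA : HasRealRankZero A) {v : unitary A}
    (hv : ‖(v - 1 : A)‖ < 2) {δ : ℝ} (hδ : 0 < δ) [PartialOrder A] [StarOrderedRing A] :
    ∃ (v' : unitary A) (J C k : A), ‖(v - v' : A)‖ < δ ∧ (v' : A) = C + Complex.I • k ∧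
      IsSelfAdjoint J ∧ J * J = 1 ∧ Commute J C ∧ IsSelfAdjoint C ∧ IsSelfAdjoint k ∧
      0 ≤ k * J := by
  have hvb : v ∈ Metric.ball (1 : unitary A) 2 := by
    simpa [Subtype.dist_eq, dist_eq_norm] using hv
  have hπ : argSelfAdjoint v ∈ Metric.ball (0 : selfAdjoint A) Real.pi :=
    Unitary.openPartialHomeomorph.map_source hvb
  have hopen : IsOpen (Metric.ball (0 : selfAdjoint A) Real.pi ∩ expUnitary ⁻¹' Metric.ball v δ) :=
    Metric.isOpen_ball.inter (Metric.isOpen_ball.preimage continuous_expUnitary)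
  -- The argument of `v` has norm less than `π`, so it can be moved to an invertible element of norm
  -- still below `π`, whose sign function is continuous on the spectrum.
  obtain ⟨a, ⟨haπ, hav⟩, hau⟩ := hA.inter_open_nonempty _ hopen
    ⟨argSelfAdjoint v, hπ, by simp [expUnitary_argSelfAdjoint hv, hδ]⟩
  have hne : ∀ x ∈ spectrum ℝ (a : A), x ≠ 0 := fun x hx h0 =>
    (spectrum.zero_notMem_iff ℝ).2 hau (h0 ▸ hx)
  have hcont : ContinuousOn (fun x : ℝ => x / |x|) (spectrum ℝ (a : A)) :=
    continuousOn_id.div continuous_abs.continuousOn fun x hx => abs_ne_zero.2 (hne x hx)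
  refine ⟨expUnitary a, cfc (fun x : ℝ => x / |x|) (a : A), cfc Real.cos (a : A),
    cfc Real.sin (a : A), ?_, coe_expUnitary_eq a, cfc_predicate _ _, ?_,
    cfc_commute_cfc _ _ _, cfc_predicate _ _, cfc_predicate _ _, ?_⟩
  · rw [norm_sub_rev]
    simpa [Subtype.dist_eq, dist_eq_norm] using hav
  · rw [← cfc_mul _ _ (a : A), ← cfc_const_one ℝ (a : A)]
    refine cfc_congr fun x hx => ?_
    have := hne x hx
    change x / |x| * (x / |x|) = 1
    rw [div_mul_div_comm, abs_mul_abs_self, div_self (mul_ne_zero this this)]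
  · rw [← cfc_mul _ _ (a : A)]
    refine cfc_nonneg fun x hx => ?_
    have hxπ : |x| < Real.pi := by
      rcases subsingleton_or_nontrivial A with h | h
      · simp [spectrum.of_subsingleton] at hx
      have h1 : ‖x‖ ≤ ‖(a : A)‖ := spectrum.norm_le_norm_of_mem hx
      rw [mem_ball_zero_iff] at haπ
      exact h1.trans_lt haπ
    rcases le_total 0 x with h0 | h0
    · exact mul_nonneg (Real.sin_nonneg_of_nonneg_of_le_pi h0 (abs_of_nonneg h0 ▸ hxπ.le)) (div_nonneg h0 (abs_nonneg x))
    · exact mul_nonneg_of_nonpos_of_nonpos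
        (Real.sin_nonpos_of_nonpos_of_neg_pi_le h0 (by rw [abs_of_nonpos h0] at hxπ; linarith))
        (div_nonpos_of_nonpos_of_nonneg h0 (abs_nonneg x))

/-- Both inequalities hold without error for the pair `C'`, `k'`; multiplication by the unitary `J`
preserves norms, so each error is at most `2 · 1/1000`. -/
theorem glue_hypotheses [PartialOrder A] [StarOrderedRing A] {J C k C' k' : A}
    (hJ : IsSelfAdjoint J) (hJJ : J * J = 1) (hJC : Commute J C') (hkJ : 0 ≤ k' * J)
    (hC : IsSelfAdjoint C) (hk : IsSelfAdjoint k)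
    (hk' : IsSelfAdjoint k') (h1 : ‖C - C'‖ ≤ 1 / 1000) (h2 : ‖k - k'‖ ≤ 1 / 1000) :
    C - algebraMap ℝ A (1 / 500) ≤ J * C * J ∧
      -algebraMap ℝ A (1 / 500) ≤ k * J + J * k := by
  let U : unitary A := ⟨J, Unitary.mem_iff.2 (by rw [hJ.star_eq]; exact ⟨hJJ, hJJ⟩)⟩
  have hl : ∀ x : A, ‖J * x‖ = ‖x‖ := fun x => CStarRing.norm_coe_unitary_mul U x
  have hr : ∀ x : A, ‖x * J‖ = ‖x‖ := fun x => CStarRing.norm_mul_coe_unitary x U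
  constructor
  · have e : J * C * J - C = J * (C - C') * J - (C - C') := by
      have : J * C' * J = C' := by rw [hJC.eq, mul_assoc, hJJ, mul_one]
      rw [mul_sub, sub_mul, this]; abel
    have hs : IsSelfAdjoint (J * C * J - C) := by
      refine IsSelfAdjoint.sub ?_ hC
      rw [IsSelfAdjoint, star_mul, star_mul, hJ.star_eq, hC.star_eq, mul_assoc]
    have hn : ‖J * C * J - C‖ ≤ 1 / 500 := by
      rw [e]
      refine (norm_sub_le _ _).trans ?_
      rw [hr, hl]
      linarith
    have := (neg_le_neg (algebraMap_mono A hn)).trans (IsSelfAdjoint.neg_algebraMap_norm_le_self hs)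
    rw [neg_le_sub_iff_le_add] at this
    exact sub_le_iff_le_add.2 this
  · have hJk : J * k' = k' * J := by
      have := IsSelfAdjoint.of_nonneg hkJ
      rw [← this.star_eq, star_mul, hJ.star_eq, hk'.star_eq]
    have hs : IsSelfAdjoint ((k - k') * J + J * (k - k')) := by
      rw [IsSelfAdjoint, star_add, star_mul, star_mul, hJ.star_eq, (hk.sub hk').star_eq, add_comm]
    have hn : ‖(k - k') * J + J * (k - k')‖ ≤ 1 / 500 := by
      refine (norm_add_le _ _).trans ?_
      rw [hr, hl]
      linarith
    have := (neg_le_neg (algebraMap_mono A hn)).trans (IsSelfAdjoint.neg_algebraMap_norm_le_self hs)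
    refine this.trans ?_
    have e : k * J + J * k = ((k - k') * J + J * (k - k')) + (k' * J + k' * J) := by
      nth_rewrite 2 [← hJk]; noncomm_ring
    rw [e]
    exact le_add_of_nonneg_right (add_nonneg hkJ hkJ)

/-- In real rank zero, a unitary close to one that admits a splitting symmetry lies in the closure
of the unitaries at distance less than `2` from `1`. -/
theorem exists_near_of_split (hA : HasRealRankZero A) [PartialOrder A] [StarOrderedRing A]
    {w v : unitary A} {J C' k' : A} (hwv : ‖(w - v : A)‖ ≤ 1 / 1000)
    (hv : (v : A) = C' + Complex.I • k') (hJ : IsSelfAdjoint J) (hJJ : J * J = 1)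
    (hJC : Commute J C') (hC' : IsSelfAdjoint C') (hk' : IsSelfAdjoint k') (hkJ : 0 ≤ k' * J)
    {η : ℝ} (hη : 0 < η) :
    ∃ v' : unitary A, ‖(v' - 1 : A)‖ < 2 ∧ ‖(v' - w : A)‖ < η := by
  obtain ⟨hsum, hCk⟩ := realPart_mul_self_add w
  have hw := realPart_add_I_smul_imaginaryPart (w : A)
  have hvC : C' = ℜ (v : A) := by
    rw [hv]; simp [hC'.coe_realPart, hk'.imaginaryPart]
  have hvk : k' = ℑ (v : A) := by
    rw [hv]; simp [hk'.coe_realPart, hC'.imaginaryPart]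
  have h1 : ‖(ℜ (w : A) : A) - C'‖ ≤ 1 / 1000 := by
    have : (ℜ (w : A) : A) - C' = ℜ (w - v : A) := by rw [map_sub, hvC]; rfl
    rw [this]
    exact (realPart.norm_le _).trans hwv
  have h2 : ‖(ℑ (w : A) : A) - k'‖ ≤ 1 / 1000 := by
    have : (ℑ (w : A) : A) - k' = ℑ (w - v : A) := by rw [map_sub, hvk]; rfl
    rw [this]
    exact (imaginaryPart.norm_le _).trans hwv
  set C : A := ((ℜ (w : A) : selfAdjoint A) : A)
  set k : A := ((ℑ (w : A) : selfAdjoint A) : A)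
  have hC : IsSelfAdjoint C := (ℜ (w : A)).2
  have hk : IsSelfAdjoint k := (ℑ (w : A)).2
  obtain ⟨g1, g2⟩ := glue_hypotheses hJ hJJ hJC hkJ hC hk hk' h1 h2
  have hle := le_glue_mul_self hC hCk hsum hJ g1 g2
  have hup := glue_mul_self_le hC hk hJ hsum hJJ
  have hpatch := patch_self (h := glue C k J) hC hk
    (fun b hb hb0 => mul_cfc_glue hC hk hCk hsum hJ hle hb hb0)
    (fun b hb hb0 hbn => realPart_mul_cfc_glue hC hk hCk hsum hJ hle hb hb0 hbn)
  rw [hw] at hpatch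
  let h : selfAdjoint A := ⟨glue C k J, isSelfAdjoint_glue hk hJ⟩
  -- Taking the unitary part multiplies the distance by at most `4`, and `4η/5 < η`.
  set ε : ℝ := min (1 / 400000) (η / 5) with hε
  have hε0 : 0 < ε := by positivity
  have c1 : Continuous fun a : selfAdjoint A => ‖(h : A) * h - (a : A) * a‖ := by fun_prop
  have c2 : Continuous fun a : selfAdjoint A => ‖patch (w : A) (a : A) - w‖ :=
    ((continuous_patch (w : A)).sub continuous_const).norm
  have hopen : IsOpen ({a : selfAdjoint A | ‖(h : A) * h - (a : A) * a‖ < 1 / 10000} ∩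
      {a : selfAdjoint A | ‖patch (w : A) (a : A) - w‖ < ε}) :=
    (isOpen_lt c1 continuous_const).inter (isOpen_lt c2 continuous_const)
  obtain ⟨a, ⟨ha1, ha2⟩, hau⟩ := hA.inter_open_nonempty _ hopen
    ⟨h, by simp, by simpa [h, hpatch] using hε0⟩
  obtain ⟨v', hv1, hv2⟩ := exists_unitary_of_patch hw.symm hC hk hup h.2 a.2 hau ha1.le
    (min_le_left _ _) ha2.le
  refine ⟨v', hv1, hv2.trans_lt ?_⟩
  have : ε ≤ η / 5 := min_le_right _ _
  linarith

theorem exists_near_of_mem_identityUnitary (hA : HasRealRankZero A) {u : unitary A}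
    (hu : u ∈ identityUnitary A) {η : ℝ} (hη : 0 < η) :
    ∃ v : unitary A, ‖(v - 1 : A)‖ < 2 ∧ ‖(v - u : A)‖ < η := by
  let _ : PartialOrder A := CStarAlgebra.spectralOrder A
  have _ : StarOrderedRing A := CStarAlgebra.spectralOrderedRing A
  set S : Set (unitary A) := closure (Metric.ball 1 2) with hS
  have hclopen : IsClopen S := by
    -- Three steps of size `1/4000` lead from `w` to a unitary with a splitting symmetry, within the
    -- tolerance `1/1000`. This width does not depend on the spectral gap of `v` at `-1`.
    refine .of_thickening_subset_self (δ := 1 / 4000) (by norm_num) fun w hw => ?_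
    obtain ⟨x, hx, hwx⟩ := Metric.mem_thickening_iff.1 hw
    obtain ⟨v, hv, hxv⟩ := Metric.mem_closure_iff.1 hx (1 / 4000) (by norm_num)
    rw [Metric.mem_ball, Subtype.dist_eq, dist_eq_norm] at hv
    obtain ⟨v', J, C, k, hvv', hv', hJ, hJJ, hJC, hC, hk, hkJ⟩ :=
      exists_split_near hA (by simpa using hv)
        (by norm_num : (0 : ℝ) < 1 / 4000)
    refine Metric.mem_closure_iff.2 fun ε hε => ?_
    have hwv' : dist w v' ≤ 1 / 1000 := by
      have h3 : dist v v' < 1 / 4000 := by rwa [Subtype.dist_eq, dist_eq_norm]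
      linarith [dist_triangle w x v', dist_triangle x v v']
    rw [Subtype.dist_eq, dist_eq_norm] at hwv'
    obtain ⟨y, hy1, hy2⟩ := exists_near_of_split hA hwv' hv' hJ hJJ hJC hC hk hkJ hε
    refine ⟨y, ?_, ?_⟩
    · simpa [Subtype.dist_eq, dist_eq_norm] using hy1
    · rwa [dist_comm, Subtype.dist_eq, dist_eq_norm]
  have huS : u ∈ S := hclopen.connectedComponent_subset
    (subset_closure (Metric.mem_ball_self two_pos)) hu
  obtain ⟨v, hv, huv⟩ := Metric.mem_closure_iff.1 huS η hη
  refine ⟨v, ?_, ?_⟩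
  · simpa [Subtype.dist_eq, dist_eq_norm] using hv
  · rwa [dist_comm, Subtype.dist_eq, dist_eq_norm] at huv

/-- A C⋆-algebra of real rank zero has exponential length at most `2π`. -/
theorem HasRealRankZero.cel_le (hA : HasRealRankZero A) :
    cel A ≤ ENNReal.ofReal Real.pi + ENNReal.ofReal Real.pi := by
  have hball : ∀ v : unitary A, ‖(v - 1 : A)‖ < 2 → expLength v ≤ ENNReal.ofReal Real.pi :=
    fun v hv => (expLength_le_of_norm_sub_one_lt_two hv).trans
      (ENNReal.ofReal_le_ofReal (norm_argSelfAdjoint_le_pi v))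
  refine iSup₂_le fun u hu => ?_
  obtain ⟨v, hv, hvu⟩ := exists_near_of_mem_identityUnitary hA hu two_pos
  have h1 : ‖((u * star v : unitary A) - 1 : A)‖ < 2 := by
    rw [← Unitary.norm_sub_eq, norm_sub_rev]; exact hvu
  calc expLength u = expLength ((u * star v) * v) := by
        rw [mul_assoc, Unitary.star_mul_self, mul_one]
    _ ≤ expLength (u * star v) + expLength v := expLength_mul_le _ _
    _ ≤ _ := add_le_add (hball _ h1) (hball _ hv)

end RealRankZero

theorem mainTheorem1 (A : Type u) [CStarAlgebra A] :
    (IsHejcmanBounded (identityUnitary A) ↔ cel A < ⊤) ∧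
    (HasPropertyOB (identityUnitary A) ↔ cel A < ⊤) ∧
    (HasRealRankZero A → IsHejcmanBounded (identityUnitary A)) :=
  ⟨⟨fun h => h.hasPropertyOB.cel_lt_top, isHejcmanBounded_of_cel_lt_top⟩,
    ⟨fun h => h.cel_lt_top, fun h => (isHejcmanBounded_of_cel_lt_top h).hasPropertyOB⟩,
    fun hA => isHejcmanBounded_of_cel_lt_top
      (hA.cel_le.trans_lt (ENNReal.add_lt_top.2 ⟨ENNReal.ofReal_lt_top, ENNReal.ofReal_lt_top⟩))⟩
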